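/- Let $L(q_0,q_1)$ denote the boundary value problem $$-y''+(2\lambda q_1(x)+q_0(x))y=\lambda^2y,\quad x\in(0,\pi),\qquad y(0)=y(\pi)=0,$$ where $q_1\in L_2(0,\pi)$ and $q_0\in W_2^{-1}(0,\pi)$ are complex-valued, that is, $q_0=\sigma'$ in the sense of distributions on $(0,\pi)$ for some complex-valued $\sigma\in L_2(0,\pi)$. With the quasi-derivative $y^{[1]}:=y'-\sigma y$, the equation is understood as $$-(y^{[1]})'-\sigma y^{[1]}-\sigma^2y+2\lambda q_1y=\lambda^2y\ \text{ a.e. on }(0,\pi),\qquad y,\,y^{[1]}\in AC[0,\pi].$$ Let $S(x,\lambda)$ be the solution with $S(0,\lambda)=0$, $S^{[1]}(0,\lambda)=1$, and put $\Delta(\lambda):=S(\pi,\lambda)$. The eigenvalues of $L(q_0,q_1)$ are the zeros of the entire function $\Delta$; let $\{\lambda_n\}_{n\in\mathbb Z_0}$, $\mathbb Z_0:=\mathbb Z\setminus\{0\}$, be a list of them in which every zero occurs as many times as its multiplicity. Put $$\mathbb S:=\{n\in\mathbb Z_0:\ \lambda_k\ne\lambda_n\ \text{for all } k\in\mathbb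 Z_0,\ k<n\},\qquad m_n:=\#\{k\in\mathbb Z_0:\lambda_k=\lambda_n\},$$ and let the numbering be such that $\lambda_n\ne\lambda_k$ whenever $nk<0$, and $\lambda_n=\lambda_{n+1}=\dots=\lambda_{n+m_n-1}$ for $n\in\mathbb S$. For $\lambda$ with $\Delta(\lambda)\neq0$ let $\Phi(x,\lambda)$ be the solution with $\Phi(0,\lambda)=1$, $\Phi(\pi,\lambda)=0$, and let $M(\lambda):=\Phi^{[1]}(0,\lambda)$ be the Weyl function, which is meromorphic in $\mathbb C$. Put $$M_{n+\nu}:=\operatorname*{Res}_{\lambda=\lambda_n}(\lambda-\lambda_n)^{\nu}M(\lambda),\qquad n\in\mathbb S,\quad \nu=0,\dots,m_n-1.$$ The collection $\{\lambda_n,M_n\}_{n\in\mathbb Z_0}$ is called the spectral data of $L(q_0,q_1)$ (it does not depend on the choice of $\sigma$). **Theorem.** Let $\{\lambda_n,M_n\}_{n\in\mathbb Z_0}$ and $\{\tilde\lambda_n,\tilde M_n\}_{n\in\mathbb Z_0}$ be spectral data of $L(q_0,q_1)$ and $L(\tilde q_0,\tilde q_1)$, where $q_1,\tilde q_1\in L_2(0,\pi)$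 and $q_0,\tilde q_0\in W_2^{-1}(0,\pi)$ are complex-valued. If $\lambda_n=\tilde\lambda_n$ and $M_n=\tilde M_n$ for all $n\in\mathbb Z_0$, then $q_0=\tilde q_0$ in $W_2^{-1}(0,\pi)$ and $q_1=\tilde q_1$ in $L_2(0,\pi)$. Thus, the spectral data determine $q_0$ and $q_1$ uniquely. -/

import Mathlib

open MeasureTheory Filter Topology

noncomputable section

namespace QuadraticPencil

/-- The interval `(0, π)` as an open subset of `ℝ`. -/
def interval : TopologicalSpace.Opens ℝ := ⟨Set.Ioo 0 Real.pi, isOpen_Ioo⟩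

/-- The complex space `L₂(0, π)`. -/
abbrev L2 : Type := Lp ℂ 2 (volume.restrict (Set.Ioo 0 Real.pi))

/-- Complex-valued distributions on `(0, π)`. -/
abbrev Distr : Type := Distribution interval ℂ ⊤

/-- `q₀ = σ'` in the sense of distributions on `(0, π)`. -/
def IsDistribDeriv (σ : L2) (q₀ : Distr) : Prop :=
  ∀ φ : TestFunction interval ℝ ⊤,
    q₀ φ = -∫ x in Set.Ioo 0 Real.pi, ((deriv φ x : ℝ) : ℂ) * σ x

/-- `q₀ ∈ W₂⁻¹(0, π)`: the distribution `q₀` is the derivative of a function from `L₂(0, π)`. -/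
def MemW2NegOne (q₀ : Distr) : Prop := ∃ σ : L2, IsDistribDeriv σ q₀

/-- `y` is a solution on `[0, π]` of the equation `ℓ(y) + 2 μ q₁ y = μ² y`, where
`ℓ(y) = -(y^{[1]})' - σ y^{[1]} - σ² y`, and `y1` is its quasi-derivative `y^{[1]} = y' - σ y`.
Both `y` and `y^{[1]}` are absolutely continuous and the equations hold almost everywhere. -/
structure IsSolution (σ q₁ : L2) (μ : ℂ) (y y1 : ℝ → ℂ) : Prop where
  ac : AbsolutelyContinuousOnInterval y 0 Real.pi
  ac_quasi : AbsolutelyContinuousOnInterval y1 0 Real.pi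
  quasi : ∀ᵐ x ∂(volume.restrict (Set.Ioo 0 Real.pi)),
    HasDerivAt y (y1 x + σ x * y x) x
  eqn : ∀ᵐ x ∂(volume.restrict (Set.Ioo 0 Real.pi)),
    ∃ d : ℂ, HasDerivAt y1 d x ∧
      (-d - σ x * y1 x - σ x ^ 2 * y x) + 2 * μ * q₁ x * y x = μ ^ 2 * y x

/-- `Δ(μ) = S(π, μ)`, where `S(·, μ)` is the solution with `S(0, μ) = 0`, `S^{[1]}(0, μ) = 1`. -/
def IsCharFunction (σ q₁ : L2) (Δ : ℂ → ℂ) : Prop :=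
  ∀ μ : ℂ, ∃ S S1 : ℝ → ℂ, IsSolution σ q₁ μ S S1 ∧ S 0 = 0 ∧ S1 0 = 1 ∧ Δ μ = S Real.pi

/-- `W` is the Weyl function: for every `μ` which is not an eigenvalue (that is, `Δ(μ) ≠ 0`),
`W(μ) = Φ^{[1]}(0, μ)`, where `Φ(·, μ)` is the solution with `Φ(0, μ) = 1`, `Φ(π, μ) = 0`.
The values of `W` at the eigenvalues (the poles) are irrelevant. -/
def IsWeylFunction (σ q₁ : L2) (Δ W : ℂ → ℂ) : Prop :=
  ∀ μ : ℂ, Δ μ ≠ 0 →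
    ∃ Φ Φ1 : ℝ → ℂ, IsSolution σ q₁ μ Φ Φ1 ∧ Φ 0 = 1 ∧ Φ Real.pi = 0 ∧ W μ = Φ1 0

/-- `c` is the residue of `f` at the isolated singularity `z`. -/
def HasResidueAt (f : ℂ → ℂ) (z c : ℂ) : Prop :=
  ∀ᶠ r : ℝ in 𝓝[>] 0, (2 * (Real.pi : ℂ) * Complex.I)⁻¹ * (∮ ζ in C(z, r), f ζ) = c

/-- The index set `𝕊` of the first occurrences: `n ≠ 0` such that `lam k ≠ lam n` for all
nonzero `k < n`.  Sequences over `ℤ \ {0}` are written as functions on `ℤ` whose value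
at `0` is never used. -/
def firstIndices (lam : ℤ → ℂ) : Set ℤ :=
  {n | n ≠ 0 ∧ ∀ k : ℤ, k ≠ 0 → k < n → lam k ≠ lam n}

/-- `m_n`, the number of nonzero indices `k` with `lam k = lam n`. -/
def mult (lam : ℤ → ℂ) (n : ℤ) : ℕ := {k : ℤ | k ≠ 0 ∧ lam k = lam n}.ncard

/-- The numbering convention: positive and negative indices carry different values, and
equal values stand next to each other. -/
structure IsOrdered (lam : ℤ → ℂ) : Prop where
  sign : ∀ n k : ℤ, n * k < 0 → lam n ≠ lam k
  consecutive : ∀ n ∈ firstIndices lam, ∀ ν : ℕ, ν < mult lam n → lam (n + ν) = lam n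

/-- `{lam n, M n}`, `n ∈ ℤ \ {0}`, are the spectral data of the problem `L(q₀, q₁)`:
`lam` lists the zeros of the characteristic function with their multiplicities, subject to the
numbering convention, and `M (n + ν)` is the residue of `(μ - lam n)^ν W(μ)` at `lam n` for
`n ∈ 𝕊`, `0 ≤ ν < m_n`.  The data do not depend on the choice of the antiderivative `σ` of `q₀`. -/
def IsSpectralData (q₀ : Distr) (q₁ : L2) (lam M : ℤ → ℂ) : Prop :=
  ∃ (σ : L2) (Δ W : ℂ → ℂ),
    IsDistribDeriv σ q₀ ∧
    IsCharFunction σ q₁ Δ ∧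
    IsWeylFunction σ q₁ Δ W ∧
    (∀ z : ℂ, {n : ℤ | n ≠ 0 ∧ lam n = z}.encard = analyticOrderAt Δ z) ∧
    IsOrdered lam ∧
    ∀ n ∈ firstIndices lam, ∀ ν : ℕ, ν < mult lam n →
      HasResidueAt (fun μ => (μ - lam n) ^ ν * W μ) (lam n) (M (n + ν))

end QuadraticPencil

end

/-!
The Weyl function `M = -C(π, ·) / S(π, ·)` of the pencil, where `S`, `C` is the fundamental system
normalized at `0`, determines the coefficients, and the spectral data determine `M` up to an
additive constant which is harmless.

*From the spectral data to Weyl functions.* The residues of `(μ - λ_n)^ν M(μ)` are the coefficients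
of the principal part of `M` at `λ_n`, so two Weyl functions with the same data differ by an entire
function `E` (`exists_entire_sub_weyl`). Since `M(μ) = ± i μ (1 + o(1))` as `Im μ → ±∞`
(`Fundamental.tendsto_weyl`), `E(μ) = o(μ)` there. The solutions are entire in `μ`, and the crude
bound `exp(A (1 + |μ|)²)` is enough: a quotient of two such functions is still of this size in
every horizontal strip (`norm_quotient_le`), and then Phragmén–Lindelöf in a strip and Liouville's
theorem (`eq_const_of_tendsto`) show that `E` is a constant `e`. The constant is left undetermined;
it reflects the freedom of adding a constant to `σ`.

*From Weyl functions to coefficients.* For `0 < x < π` the combination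
`C S' - S C' + e S S'` of the two fundamental systems is entire in `μ`, and it tends to zero in both
half-planes because the diagonal of Green's function does (`Fundamental.tendsto_green`). Hence it
vanishes (`Fundamental.crossed_eq_zero`), and `S / S'` is an entire function. As `Im μ → +∞` one has
`S(x, μ) ~ -exp(-i μ x + i ∫₀ˣ q₁) / (2 i μ)` (`Fundamental.tendsto_S`), and in the lower half-plane
the same holds with `μ` and `q₁` replaced by `-μ` and `-q₁`. So `S / S'` is constant and equals
both `exp(i ∫₀ˣ (q₁ - q₁'))` and its inverse. Differentiating in `x` gives `q₁ = q₁'`; thus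
`S = S'` and `C' = C + e S`. Finally, comparing the quasi-derivatives of these solutions at `μ = 0`
shows that `σ' - σ` is constant (`Fundamental.ae_s_sub_eq_const`), that is, `q₀ = q₀'`.

The asymptotics rest on a dichotomy: in the eigenbasis of the leading part and after division by the
growing exponential, the system has bounded solutions, one component of which is exponentially
damped (`tendsto_of_dichotomySystem`). Only integrability of `σ`, `σ²` and `q₁` is used.
-/

namespace QuadraticPencil

/-! ### Absolutely continuous functions with a prescribed derivative -/

/-- `f` is absolutely continuous on `[a, b]` and `f'` is its derivative almost everywhere
on `(a, b)`. -/
structure ACDeriv {𝕜 : Type*} [RCLike 𝕜] (f f' : ℝ → 𝕜) (a b : ℝ) : Prop where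
  ac : AbsolutelyContinuousOnInterval f a b
  deriv_ae : ∀ᵐ x : ℝ, x ∈ Set.Ioo a b → HasDerivAt f (f' x) x

namespace ACDeriv

variable {𝕜 : Type*} [RCLike 𝕜] {f f' g g' : ℝ → 𝕜} {a b : ℝ}

lemma add (hf : ACDeriv f f' a b) (hg : ACDeriv g g' a b) :
    ACDeriv (fun x => f x + g x) (fun x => f' x + g' x) a b := by
  refine ⟨hf.ac.fun_add hg.ac, ?_⟩
  filter_upwards [hf.deriv_ae, hg.deriv_ae] with x h1 h2 hx using (h1 hx).add (h2 hx)

lemma mul (hf : ACDeriv f f' a b) (hg : ACDeriv g g' a b) :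
    ACDeriv (fun x => f x * g x) (fun x => f' x * g x + f x * g' x) a b := by
  refine ⟨hf.ac.fun_smul hg.ac, ?_⟩
  filter_upwards [hf.deriv_ae, hg.deriv_ae] with x h1 h2 hx using (h1 hx).mul (h2 hx)

lemma const_mul (c : 𝕜) (hf : ACDeriv f f' a b) :
    ACDeriv (fun x => c * f x) (fun x => c * f' x) a b := by
  refine ⟨hf.ac.const_smul c, ?_⟩
  filter_upwards [hf.deriv_ae] with x h1 hx using (h1 hx).const_mul c

lemma sub (hf : ACDeriv f f' a b) (hg : ACDeriv g g' a b) :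
    ACDeriv (fun x => f x - g x) (fun x => f' x - g' x) a b := by
  refine ⟨hf.ac.fun_sub hg.ac, ?_⟩
  filter_upwards [hf.deriv_ae, hg.deriv_ae] with x h1 h2 hx using (h1 hx).sub (h2 hx)

lemma congr_deriv (hf : ACDeriv f f' a b) (h : ∀ᵐ x : ℝ, x ∈ Set.Ioo a b → f' x = g' x) :
    ACDeriv f g' a b := by
  refine ⟨hf.ac, ?_⟩
  filter_upwards [hf.deriv_ae, h] with x h1 h2 hx
  rw [← h2 hx]; exact h1 hx

lemma mono (hf : ACDeriv f f' a b) {c d : ℝ} (hac : a ≤ c) (hcd : c ≤ d) (hdb : d ≤ b) :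
    ACDeriv f f' c d := by
  refine ⟨hf.ac.mono ?_, ?_⟩
  · rw [Set.uIcc_of_le hcd, Set.uIcc_of_le (hac.trans (hcd.trans hdb))]
    exact Set.Icc_subset_Icc hac hdb
  · filter_upwards [hf.deriv_ae] with x h1 hx using h1 ⟨hac.trans_lt hx.1, hx.2.trans_le hdb⟩

lemma continuousOn (hf : ACDeriv f f' a b) (hab : a ≤ b) : ContinuousOn f (Set.Icc a b) := by
  simpa [Set.uIcc_of_le hab] using hf.ac.continuousOn

/-- A continuously differentiable function of an absolutely continuous function is absolutely
continuous, because it is Lipschitz on the (bounded) range. -/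
lemma comp {φ φ' : 𝕜 → 𝕜} (hφ : ContDiff ℝ 1 φ) (hφ' : ∀ z, HasDerivAt φ (φ' z) z)
    (hf : ACDeriv f f' a b) :
    ACDeriv (fun x => φ (f x)) (fun x => φ' (f x) * f' x) a b := by
  constructor
  · obtain ⟨R, hR⟩ := hf.ac.exists_bound
    obtain ⟨K, hK⟩ := (hφ.contDiffOn (s := Metric.closedBall 0 R)).exists_lipschitzOnWith
      (by decide) (convex_closedBall _ _) (isCompact_closedBall _ _)
    have hlim : Tendsto (fun E : ℕ × (ℕ → ℝ × ℝ) =>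
        (K : ℝ) * ∑ i ∈ Finset.range E.1, dist (f (E.2 i).1) (f (E.2 i).2))
        (AbsolutelyContinuousOnInterval.totalLengthFilter ⊓
          𝓟 (AbsolutelyContinuousOnInterval.disjWithin a b)) (𝓝 0) := by
      simpa using Tendsto.const_mul (K : ℝ) hf.ac
    refine squeeze_zero' (Eventually.of_forall fun E => Finset.sum_nonneg fun i _ => dist_nonneg)
      ?_ hlim
    filter_upwards [mem_inf_of_right (mem_principal_self _)] with E hE
    rw [Finset.mul_sum]
    refine Finset.sum_le_sum fun i hi => ?_
    obtain ⟨h1, h2⟩ := hE.1 i hi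
    exact hK.dist_le_mul _ (by simpa using hR _ h1) _ (by simpa using hR _ h2)
  · filter_upwards [hf.deriv_ae] with x h1 hx
    exact (hφ' (f x)).comp x (h1 hx)

/-- The derivative of an absolutely continuous function is integrable. -/
lemma intervalIntegrable (hf : ACDeriv f f' a b) (hab : a ≤ b) :
    IntervalIntegrable f' volume a b := by
  have hre : AbsolutelyContinuousOnInterval (fun x => RCLike.re (f x)) a b := by
    refine squeeze_zero (fun E => Finset.sum_nonneg fun i _ => dist_nonneg)
      (fun E => Finset.sum_le_sum fun i _ => ?_) hf.ac
    simpa [dist_eq_norm, ← map_sub] using RCLike.abs_re_le_norm (f (E.2 i).1 - f (E.2 i).2)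
  have him : AbsolutelyContinuousOnInterval (fun x => RCLike.im (f x)) a b := by
    refine squeeze_zero (fun E => Finset.sum_nonneg fun i _ => dist_nonneg)
      (fun E => Finset.sum_le_sum fun i _ => ?_) hf.ac
    simpa [dist_eq_norm, ← map_sub] using RCLike.abs_im_le_norm (f (E.2 i).1 - f (E.2 i).2)
  have h1 := hre.intervalIntegrable_deriv
  have h2 := him.intervalIntegrable_deriv
  rw [intervalIntegrable_iff_integrableOn_Ioo_of_le hab] at h1 h2 ⊢
  have h1' : IntegrableOn (fun x => RCLike.re (f' x)) (Set.Ioo a b) := by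
    refine h1.congr_fun_ae ?_
    rw [Filter.EventuallyEq, ae_restrict_iff' measurableSet_Ioo]
    filter_upwards [hf.deriv_ae] with x hx hm
    exact ((RCLike.reCLM (K := 𝕜)).hasFDerivAt.comp_hasDerivAt x (hx hm)).deriv
  have h2' : IntegrableOn (fun x => RCLike.im (f' x)) (Set.Ioo a b) := by
    refine h2.congr_fun_ae ?_
    rw [Filter.EventuallyEq, ae_restrict_iff' measurableSet_Ioo]
    filter_upwards [hf.deriv_ae] with x hx hm
    exact ((RCLike.imCLM (K := 𝕜)).hasFDerivAt.comp_hasDerivAt x (hx hm)).deriv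
  exact Integrable.re_im_iff.1 ⟨h1', h2'⟩

end ACDeriv

/-- The primitive of an integrable function is absolutely continuous. -/
lemma absolutelyContinuous_of_eq_integral {𝕜 : Type*} [RCLike 𝕜] {f f' : ℝ → 𝕜} {a b : ℝ}
    (hab : a ≤ b) (hi : IntervalIntegrable f' volume a b)
    (h : ∀ x ∈ Set.Icc a b, f x = f a + ∫ t in a..x, f' t) :
    AbsolutelyContinuousOnInterval f a b := by
  have hn : IntervalIntegrable (fun t => ‖f' t‖) volume a b := hi.norm
  have hac := hn.absolutelyContinuousOnInterval_intervalIntegral (c := a) (by simp)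
  refine squeeze_zero' (Eventually.of_forall fun E => Finset.sum_nonneg fun i _ => dist_nonneg)
    ?_ hac
  filter_upwards [mem_inf_of_right (mem_principal_self _)] with E hE
  refine Finset.sum_le_sum fun i hi' => ?_
  obtain ⟨h1, h2⟩ := hE.1 i hi'
  rw [Set.uIcc_of_le hab] at h1 h2
  have sub : ∀ {x}, x ∈ Set.Icc a b → IntervalIntegrable f' volume a x := fun hx =>
    hi.mono_set (by
      rw [Set.uIcc_of_le hx.1, Set.uIcc_of_le hab]; exact Set.Icc_subset_Icc_right hx.2)
  rw [h _ h1, h _ h2, dist_add_left, dist_eq_norm, dist_eq_norm,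
    intervalIntegral.integral_interval_sub_left (sub h1) (sub h2),
    intervalIntegral.integral_interval_sub_left (sub h1).norm (sub h2).norm]
  exact intervalIntegral.norm_integral_le_abs_integral_norm

namespace ACDeriv

variable {𝕜 : Type*} [RCLike 𝕜] {f f' g g' : ℝ → 𝕜} {a b : ℝ}

lemma of_integral (hab : a ≤ b) (hi : IntervalIntegrable f' volume a b)
    (h : ∀ x ∈ Set.Icc a b, f x = f a + ∫ t in a..x, f' t) : ACDeriv f f' a b := by
  refine ⟨absolutelyContinuous_of_eq_integral hab hi h, ?_⟩
  filter_upwards [hi.ae_hasDerivAt_integral] with x hx hm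
  have h1 := hx (by rw [Set.uIcc_of_le hab]; exact Set.Ioo_subset_Icc_self hm) a (by simp)
  refine (h1.const_add (f a)).congr_of_eventuallyEq ?_
  filter_upwards [Ioo_mem_nhds hm.1 hm.2] with y hy
  exact h y (Set.Ioo_subset_Icc_self hy)

lemma primitive (hab : a ≤ b) (hi : IntervalIntegrable f' volume a b) :
    ACDeriv (fun x => ∫ t in a..x, f' t) f' a b :=
  of_integral hab hi (by simp)

/-- The derivative of an absolutely continuous function determines it up to a constant. -/
lemma sub_eq_of_deriv_zero (hf : ACDeriv f (fun _ => 0) a b) {x : ℝ} (hx : x ∈ Set.Icc a b) :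
    f x = f a := by
  have hab := hx.1.trans hx.2
  obtain ⟨C, hC⟩ := hf.ac.const_of_ae_hasDerivAt_zero (by
    have ha : ∀ᵐ x : ℝ, x ≠ a := by simp [ae_iff, measure_singleton]
    have hb : ∀ᵐ x : ℝ, x ≠ b := by simp [ae_iff, measure_singleton]
    filter_upwards [hf.deriv_ae, ha, hb] with y hy hya hyb hm
    rw [Set.uIcc_of_le hab] at hm
    exact hy ⟨lt_of_le_of_ne hm.1 hya.symm, lt_of_le_of_ne hm.2 hyb⟩)
  rw [Set.uIcc_of_le hab] at hC
  rw [hC x hx, hC a ⟨le_rfl, hab⟩]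

/-- The fundamental theorem of calculus for absolutely continuous functions. -/
lemma eq_integral (hf : ACDeriv f f' a b) {x : ℝ} (hx : x ∈ Set.Icc a b) :
    f x = f a + ∫ t in a..x, f' t := by
  have hab := hx.1.trans hx.2
  have h := (hf.sub (primitive hab (hf.intervalIntegrable hab))).congr_deriv
    (g' := fun _ => 0) (by simp)
  have := h.sub_eq_of_deriv_zero hx
  simp only [intervalIntegral.integral_same, sub_zero] at this
  rw [← this]; ring

lemma reflect (hf : ACDeriv f f' a b) (hab : a ≤ b) (c : ℝ) :
    ACDeriv (fun x => f (c - x)) (fun x => -f' (c - x)) (c - b) (c - a) := by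
  have hi := hf.intervalIntegrable hab
  refine of_integral (by linarith) ?_ fun x hx => ?_
  · exact (by simpa using (hi.comp_sub_left c).symm :
      IntervalIntegrable (fun x => f' (c - x)) volume (c - b) (c - a)).neg
  · rw [intervalIntegral.integral_neg, intervalIntegral.integral_comp_sub_left (fun t => f' t) c]
    have e1 := hf.eq_integral (x := c - x) ⟨by linarith [hx.2], by linarith [hx.1]⟩
    have e2 := hf.eq_integral (x := b) ⟨hab, le_rfl⟩
    have hm : c - x ∈ Set.uIcc a b := by
      rw [Set.uIcc_of_le hab]; exact ⟨by linarith [hx.2], by linarith [hx.1]⟩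
    have e3 := intervalIntegral.integral_add_adjacent_intervals
      (hi.mono_set (Set.uIcc_subset_uIcc_left hm)) (hi.mono_set (Set.uIcc_subset_uIcc_right hm))
    simp only [sub_sub_cancel]
    rw [e1, e2, ← e3]; ring

end ACDeriv

/-- Grönwall's inequality with an integrable coefficient. -/
lemma gronwall_integral {f g : ℝ → ℝ} {c a b : ℝ} (hab : a ≤ b)
    (hf : ContinuousOn f (Set.Icc a b)) (hg0 : ∀ x, 0 ≤ g x) (hg : IntervalIntegrable g volume a b)
    (h : ∀ x ∈ Set.Icc a b, f x ≤ c + ∫ t in a..x, g t * f t) :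
    ∀ x ∈ Set.Icc a b, f x ≤ c * Real.exp (∫ t in a..x, g t) := by
  intro x hx
  have hgf : IntervalIntegrable (fun t => g t * f t) volume a b :=
    hg.mul_continuousOn (by rwa [Set.uIcc_of_le hab])
  have hH : ACDeriv (fun x => c + ∫ t in a..x, g t * f t) (fun t => g t * f t) a b :=
    ACDeriv.of_integral hab hgf (by simp)
  have hE : ACDeriv (fun x => Real.exp (-1 * ∫ t in a..x, g t))
      (fun x => Real.exp (-1 * ∫ t in a..x, g t) * (-1 * g x)) a b :=
    ((ACDeriv.primitive hab hg).const_mul (-1)).comp (Real.contDiff_exp) Real.hasDerivAt_exp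
  have hHE := (hH.mul hE).eq_integral hx
  have hle : (∫ t in a..x, (g t * f t * Real.exp (-1 * ∫ t in a..t, g t) +
      (c + ∫ t in a..t, g t * f t) * (Real.exp (-1 * ∫ t in a..t, g t) * (-1 * g t)))) ≤ 0 := by
    rw [intervalIntegral.integral_of_le hx.1]
    refine setIntegral_nonpos measurableSet_Ioc fun t ht => ?_
    have h1 := h t ⟨ht.1.le, ht.2.trans hx.2⟩
    have h2 : 0 ≤ g t * Real.exp (-1 * ∫ t in a..t, g t) := mul_nonneg (hg0 t) (Real.exp_pos _).le
    nlinarith [mul_nonneg h2 (sub_nonneg.2 h1)]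
  simp only [intervalIntegral.integral_same, mul_zero, Real.exp_zero, add_zero, mul_one] at hHE
  have h3 : (c + ∫ t in a..x, g t * f t) * Real.exp (-1 * ∫ t in a..x, g t) ≤ c := by
    rw [hHE]; linarith
  calc f x ≤ c + ∫ t in a..x, g t * f t := h x hx
    _ = ((c + ∫ t in a..x, g t * f t) * Real.exp (-1 * ∫ t in a..x, g t)) *
        Real.exp (∫ t in a..x, g t) := by
      rw [mul_assoc, ← Real.exp_add]; simp
    _ ≤ c * Real.exp (∫ t in a..x, g t) := by gcongr

/-! ### Solutions of the pencil equation -/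

/-- `y`, with quasi-derivative `y1`, solves `ℓ(y) + 2 μ q y = μ² y` on `[0, π]`; here the
coefficients are functions rather than elements of `L2`, so that they can be reflected. -/
structure Sol (s q : ℝ → ℂ) (μ : ℂ) (y y1 : ℝ → ℂ) : Prop where
  fst : ACDeriv y (fun x => y1 x + s x * y x) 0 Real.pi
  snd : ACDeriv y1 (fun x => -s x * y1 x - s x ^ 2 * y x + (2 * μ * q x - μ ^ 2) * y x) 0 Real.pi

lemma IsSolution.sol {σ q : L2} {μ : ℂ} {y y1 : ℝ → ℂ} (h : IsSolution σ q μ y y1) :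
    Sol σ q μ y y1 := by
  refine ⟨⟨h.ac, (ae_restrict_iff' measurableSet_Ioo).1 h.quasi⟩, ⟨h.ac_quasi, ?_⟩⟩
  filter_upwards [(ae_restrict_iff' measurableSet_Ioo).1 h.eqn] with x hx hm
  obtain ⟨d, hd, he⟩ := hx hm
  convert! hd using 1
  linear_combination he

namespace Sol

variable {s q : ℝ → ℂ} {μ : ℂ} {y y1 z z1 : ℝ → ℂ}

lemma wronskian (hy : Sol s q μ y y1) (hz : Sol s q μ z z1) {x : ℝ}
    (hx : x ∈ Set.Icc 0 Real.pi) :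
    y1 x * z x - y x * z1 x = y1 0 * z 0 - y 0 * z1 0 := by
  refine (((hy.snd.mul hz.fst).sub (hy.fst.mul hz.snd)).congr_deriv (g' := fun _ => 0)
    (Eventually.of_forall fun t _ => ?_)).sub_eq_of_deriv_zero hx
  ring

lemma comb (hy : Sol s q μ y y1) (hz : Sol s q μ z z1) (a b : ℂ) :
    Sol s q μ (fun x => a * y x + b * z x) (fun x => a * y1 x + b * z1 x) := by
  refine ⟨((hy.fst.const_mul a).add (hz.fst.const_mul b)).congr_deriv
    (Eventually.of_forall fun t _ => ?_), ((hy.snd.const_mul a).add (hz.snd.const_mul b)).congr_deriv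
    (Eventually.of_forall fun t _ => ?_)⟩ <;> ring

lemma neg_param (hy : Sol s q μ y y1) : Sol s (fun x => -q x) (-μ) y y1 :=
  ⟨hy.fst, hy.snd.congr_deriv (Eventually.of_forall fun t _ => by ring)⟩

/-- Reversing the interval changes the sign of `σ` and of the quasi-derivative. -/
lemma reflect (hy : Sol s q μ y y1) :
    Sol (fun x => -s (Real.pi - x)) (fun x => q (Real.pi - x)) μ
      (fun x => y (Real.pi - x)) (fun x => -y1 (Real.pi - x)) := by
  have h1 := hy.fst.reflect Real.pi_pos.le Real.pi
  have h2 := (hy.snd.reflect Real.pi_pos.le Real.pi).const_mul (-1)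
  simp only [sub_self, sub_zero, neg_one_mul, neg_neg] at h1 h2
  exact ⟨h1.congr_deriv (Eventually.of_forall fun t _ => by ring),
    h2.congr_deriv (Eventually.of_forall fun t _ => by ring)⟩

/-- Uniqueness for the Cauchy problem, in terms of a fundamental system. -/
lemma eq_comb {S S1 C C1 : ℝ → ℂ} (hS : Sol s q μ S S1) (hC : Sol s q μ C C1)
    (hS0 : S 0 = 0) (hS1 : S1 0 = 1) (hC0 : C 0 = 1) (hC1 : C1 0 = 0)
    (hy : Sol s q μ y y1) {x : ℝ} (hx : x ∈ Set.Icc 0 Real.pi) :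
    y x = y 0 * C x + y1 0 * S x := by
  have h1 := hS.wronskian hC hx
  have h2 := hy.wronskian hC hx
  have h3 := hy.wronskian hS hx
  rw [hS0, hS1, hC0, hC1] at h1
  rw [hC0, hC1] at h2
  rw [hS0, hS1] at h3
  linear_combination (-y x) * h1 + S x * h2 - C x * h3

end Sol

/-! ### Growth of order two -/

/-- `f` grows at most like an entire function of order two and finite type. -/
def QuadGrowth (f : ℂ → ℂ) : Prop :=
  ∃ A : ℝ, 0 ≤ A ∧ ∀ μ, ‖f μ‖ ≤ Real.exp (A * (1 + ‖μ‖) ^ 2)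

namespace QuadGrowth

variable {f g : ℂ → ℂ}

lemma mul (hf : QuadGrowth f) (hg : QuadGrowth g) : QuadGrowth (fun μ => f μ * g μ) := by
  obtain ⟨A, hA, hf⟩ := hf
  obtain ⟨B, hB, hg⟩ := hg
  refine ⟨A + B, by positivity, fun μ => ?_⟩
  rw [norm_mul, add_mul, Real.exp_add]
  gcongr
  exacts [hf μ, hg μ]

lemma of_le {k : ℂ → ℝ} {c A : ℝ} (hA : 0 ≤ A) (hc : 0 ≤ c)
    (hk : ∀ μ, k μ ≤ A * (1 + ‖μ‖) ^ 2) (h : ∀ μ, ‖f μ‖ ≤ c * Real.exp (k μ)) :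
    QuadGrowth f := by
  refine ⟨c + A, by positivity, fun μ => (h μ).trans ?_⟩
  rw [add_mul, Real.exp_add]
  have h1 : (1 : ℝ) ≤ (1 + ‖μ‖) ^ 2 := by nlinarith [norm_nonneg μ]
  have h2 : c ≤ Real.exp (c * (1 + ‖μ‖) ^ 2) := by
    calc c ≤ c * (1 + ‖μ‖) ^ 2 := le_mul_of_one_le_right hc h1
      _ ≤ c * (1 + ‖μ‖) ^ 2 + 1 := by linarith
      _ ≤ _ := Real.add_one_le_exp _
  gcongr
  exact hk μ

lemma const (c : ℂ) : QuadGrowth (fun _ => c) :=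
  of_le (k := fun _ => 0) le_rfl (norm_nonneg c) (by simp) (by simp)

lemma add (hf : QuadGrowth f) (hg : QuadGrowth g) : QuadGrowth (fun μ => f μ + g μ) := by
  obtain ⟨A, hA, hf⟩ := hf
  obtain ⟨B, hB, hg⟩ := hg
  refine of_le (k := fun μ => (A + B) * (1 + ‖μ‖) ^ 2) (c := 2) (add_nonneg hA hB) zero_le_two
    (fun μ => le_rfl) fun μ => ?_
  have h1 : Real.exp (A * (1 + ‖μ‖) ^ 2) ≤ Real.exp ((A + B) * (1 + ‖μ‖) ^ 2) := by
    gcongr; linarith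
  have h2 : Real.exp (B * (1 + ‖μ‖) ^ 2) ≤ Real.exp ((A + B) * (1 + ‖μ‖) ^ 2) := by
    gcongr; linarith
  calc ‖f μ + g μ‖ ≤ ‖f μ‖ + ‖g μ‖ := norm_add_le _ _
    _ ≤ _ := by linarith [hf μ, hg μ]

lemma sub (hf : QuadGrowth f) (hg : QuadGrowth g) : QuadGrowth (fun μ => f μ - g μ) := by
  simpa [sub_eq_add_neg] using hf.add ((const (-1)).mul hg)

end QuadGrowth

/-! ### Existence of solutions that are entire in the spectral parameter -/

open BoundedContinuousFunction in
/-- The Volterra operator `f ↦ ∫₀ˣ a f` on bounded continuous functions; the upper limit is `|x|`,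
so that only the values of `f` on `[0, ∞)` matter. -/
noncomputable def volterra (a : ℝ → ℂ) (ha : Integrable a) : (ℝ →ᵇ ℂ) →L[ℂ] (ℝ →ᵇ ℂ) :=
  have hint (f : ℝ →ᵇ ℂ) : Integrable (fun t => a t * f t) :=
    ha.mul_bdd (c := ‖f‖) f.continuous.aestronglyMeasurable
      (Eventually.of_forall fun t => f.norm_coe_le_norm t)
  have hb (f : ℝ →ᵇ ℂ) (x : ℝ) : ‖∫ t in (0 : ℝ)..|x|, a t * f t‖ ≤ (∫ t, ‖a t‖) * ‖f‖ := by
    rw [intervalIntegral.integral_of_le (abs_nonneg x)]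
    calc ‖∫ t in Set.Ioc 0 |x|, a t * f t‖ ≤ ∫ t in Set.Ioc 0 |x|, ‖a t‖ * ‖f‖ := by
          refine norm_integral_le_of_norm_le (ha.norm.mul_const _).integrableOn
            (Eventually.of_forall fun t => ?_)
          rw [norm_mul]; gcongr; exact f.norm_coe_le_norm t
      _ ≤ ∫ t, ‖a t‖ * ‖f‖ := setIntegral_le_integral (ha.norm.mul_const _)
          (Eventually.of_forall fun t => by positivity)
      _ = _ := integral_mul_const _ _
  LinearMap.mkContinuous
    { toFun := fun f => BoundedContinuousFunction.ofNormedAddCommGroup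
        (fun x => ∫ t in (0 : ℝ)..|x|, a t * f t)
        ((intervalIntegral.continuous_primitive (fun _ _ => (hint f).intervalIntegrable) 0).comp
          continuous_abs) _ (hb f)
      map_add' := fun f g => by
        ext x
        simp only [coe_ofNormedAddCommGroup, coe_add, Pi.add_apply, mul_add]
        exact intervalIntegral.integral_add (hint f).intervalIntegrable (hint g).intervalIntegrable
      map_smul' := fun c f => by
        ext x
        simp only [coe_ofNormedAddCommGroup, coe_smul, smul_eq_mul, RingHom.id_apply]
        rw [← intervalIntegral.integral_const_mul]
        congr 1; ext t; ring }
    (∫ t, ‖a t‖) fun f => by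
      refine (norm_le (by positivity)).2 fun x => hb f x

lemma volterra_apply (a : ℝ → ℂ) (ha : Integrable a) (f : BoundedContinuousFunction ℝ ℂ) (x : ℝ) :
    volterra a ha f x = ∫ t in (0 : ℝ)..|x|, a t * f t := rfl

section Resolvent

variable {E : Type*} [NormedAddCommGroup E] [NormedSpace ℂ E] [CompleteSpace E]

/-- `1 - T` divides `1 - T ^ n`. -/
lemma isUnit_one_sub_of_norm_pow_lt_one (T : E →L[ℂ] E) (n : ℕ) (hn : ‖T ^ n‖ < 1) :
    IsUnit (1 - T) := by
  have hu : IsUnit (1 - T ^ n) := isUnit_one_sub_of_norm_lt_one hn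
  rw [← mul_neg_geom_sum] at hu
  refine ((Commute.isUnit_mul_iff ?_).1 hu).1
  exact (Commute.sum_right _ _ _ fun i _ =>
    ((Commute.one_left _).sub_left ((Commute.refl _).pow_right i)))

lemma differentiable_inverse_one_sub_quadratic (A B D : E →L[ℂ] E)
    (h : ∀ μ : ℂ, IsUnit (1 - (A + μ • B - μ ^ 2 • D))) (F : E) :
    Differentiable ℂ (fun μ : ℂ => Ring.inverse (1 - (A + μ • B - μ ^ 2 • D)) F) := fun μ => by
  have hd : DifferentiableAt ℂ (fun μ : ℂ => 1 - (A + μ • B - μ ^ 2 • D)) μ := by fun_prop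
  exact (DifferentiableAt.comp μ (differentiableAt_inverse (𝕜 := ℂ) (h μ)) hd).clm_apply
    (differentiableAt_const F)

end Resolvent

/-- Integrable coefficients on the line of the integral equation for `(y, y^{[1]})`. They stand for
`σ`, the constant `1`, `σ²` and `q₁`; each is cut off to `(0, π)`, which is why `one` is a field, and
no relation between them is needed for the resolvent estimates. -/
structure Coeffs where
  s : ℝ → ℂ
  one : ℝ → ℂ
  sq : ℝ → ℂ
  q : ℝ → ℂ
  hs : Integrable s
  hone : Integrable one
  hsq : Integrable sq
  hq : Integrable q

namespace Coeffs

variable (c : Coeffs)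

/-- Pairs of bounded continuous functions: a solution together with its quasi-derivative. -/
abbrev Pair : Type := BoundedContinuousFunction ℝ ℂ × BoundedContinuousFunction ℝ ℂ

open ContinuousLinearMap in
/-- The operator of the integral equation for `(y, y^{[1]})`, quadratic in the parameter `μ`. -/
noncomputable def op (μ : ℂ) : Pair →L[ℂ] Pair :=
  ((volterra c.s c.hs).comp (fst ℂ _ _) + (volterra c.one c.hone).comp (snd ℂ _ _)).prod
    (-(volterra c.s c.hs).comp (snd ℂ _ _) - (volterra c.sq c.hsq).comp (fst ℂ _ _)) +
  μ • (0 : Pair →L[ℂ] BoundedContinuousFunction ℝ ℂ).prod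
    ((2 : ℂ) • (volterra c.q c.hq).comp (fst ℂ _ _)) -
  μ ^ 2 • (0 : Pair →L[ℂ] BoundedContinuousFunction ℝ ℂ).prod
    ((volterra c.one c.hone).comp (fst ℂ _ _))

lemma integrable_mul {a : ℝ → ℂ} (ha : Integrable a) (f : BoundedContinuousFunction ℝ ℂ) :
    Integrable (fun t => a t * f t) :=
  ha.mul_bdd (c := ‖f‖) f.continuous.aestronglyMeasurable
      (Eventually.of_forall fun t => f.norm_coe_le_norm t)

lemma op_fst (μ : ℂ) (F : Pair) (x : ℝ) :
    (c.op μ F).1 x = ∫ t in (0 : ℝ)..|x|, (c.s t * F.1 t + c.one t * F.2 t) := by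
  rw [intervalIntegral.integral_add (integrable_mul c.hs _).intervalIntegrable
    (integrable_mul c.hone _).intervalIntegrable]
  simp [op, volterra_apply]

lemma op_snd (μ : ℂ) (F : Pair) (x : ℝ) :
    (c.op μ F).2 x = ∫ t in (0 : ℝ)..|x|, (-c.s t * F.2 t - c.sq t * F.1 t +
      (2 * μ * c.q t - μ ^ 2 * c.one t) * F.1 t) := by
  have e : ∀ t, (-c.s t * F.2 t - c.sq t * F.1 t +
      (2 * μ * c.q t - μ ^ 2 * c.one t) * F.1 t) = -(c.s t * F.2 t) - c.sq t * F.1 t +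
      (μ * 2) * (c.q t * F.1 t) - μ ^ 2 * (c.one t * F.1 t) := fun t => by ring
  have i1 : Integrable fun t => -(c.s t * F.2 t) := (integrable_mul c.hs F.2).neg
  have i2 := integrable_mul c.hsq F.1
  have i3 := (integrable_mul c.hq F.1).const_mul (μ * 2)
  have i4 := (integrable_mul c.hone F.1).const_mul (μ ^ 2)
  have i12 : Integrable fun t => -(c.s t * F.2 t) - c.sq t * F.1 t := i1.sub i2
  have i123 : Integrable fun t => -(c.s t * F.2 t) - c.sq t * F.1 t +
      μ * 2 * (c.q t * F.1 t) := i12.add i3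
  simp only [e]
  rw [intervalIntegral.integral_sub i123.intervalIntegrable i4.intervalIntegrable,
    intervalIntegral.integral_add i12.intervalIntegrable i3.intervalIntegrable,
    intervalIntegral.integral_sub i1.intervalIntegrable i2.intervalIntegrable,
    intervalIntegral.integral_neg, intervalIntegral.integral_const_mul,
    intervalIntegral.integral_const_mul]
  simp [op, volterra_apply, mul_assoc]

/-- An integrable majorant of the coefficients. -/
noncomputable def maj (μ : ℂ) (t : ℝ) : ℝ :=
  ‖c.s t‖ + ‖c.one t‖ + ‖c.sq t‖ + ‖2 * μ * c.q t - μ ^ 2 * c.one t‖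

lemma maj_nonneg (μ : ℂ) (t : ℝ) : 0 ≤ c.maj μ t := by unfold maj; positivity

lemma integrable_maj (μ : ℂ) : Integrable (c.maj μ) :=
  ((c.hs.norm.add c.hone.norm).add c.hsq.norm).add
    ((c.hq.const_mul _).sub (c.hone.const_mul _)).norm

/-- Iterated integrals of the Volterra operator gain a factorial. -/
lemma norm_op_pow_apply_le (μ : ℂ) (F : Pair) (n : ℕ) (x : ℝ) :
    ‖((c.op μ ^ n) F).1 x‖ ≤ ‖F‖ * ((∫ t in (0 : ℝ)..|x|, c.maj μ t) ^ n / n.factorial) ∧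
    ‖((c.op μ ^ n) F).2 x‖ ≤ ‖F‖ * ((∫ t in (0 : ℝ)..|x|, c.maj μ t) ^ n / n.factorial) := by
  induction n generalizing x with
  | zero =>
    simp only [pow_zero, one_apply_eq_self, Nat.factorial_zero, Nat.cast_one, div_one,
      mul_one]
    exact ⟨(F.1.norm_coe_le_norm x).trans (norm_fst_le F),
      (F.2.norm_coe_le_norm x).trans (norm_snd_le F)⟩
  | succ n ih =>
    set K : ℝ → ℝ := fun x => ∫ t in (0 : ℝ)..x, c.maj μ t with hK
    have hKd : ACDeriv (fun x => K x ^ (n + 1)) (fun x => ((n : ℝ) + 1) * K x ^ n * c.maj μ x)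
        0 |x| := by
      have := (ACDeriv.primitive (abs_nonneg x) (c.integrable_maj μ).intervalIntegrable).comp
        (φ := fun z => z ^ (n + 1)) (φ' := fun z => ((n : ℝ) + 1) * z ^ n) (by fun_prop)
        (fun z => by simpa using hasDerivAt_pow (n + 1) z)
      exact this
    have hint : IntervalIntegrable (fun t => c.maj μ t * (‖F‖ * (K t ^ n / n.factorial))) volume
        0 |x| := by
      refine (c.integrable_maj μ).intervalIntegrable.mul_continuousOn (Continuous.continuousOn ?_)
      have : Continuous K :=
        intervalIntegral.continuous_primitive (fun _ _ => (c.integrable_maj μ).intervalIntegrable) 0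
      fun_prop
    have hval : ∫ t in (0 : ℝ)..|x|, c.maj μ t * (‖F‖ * (K t ^ n / n.factorial)) =
        ‖F‖ * (K |x| ^ (n + 1) / (n + 1).factorial) := by
      have h1 := hKd.eq_integral (x := |x|) ⟨abs_nonneg x, le_rfl⟩
      have hK0 : K 0 = 0 := by simp [hK]
      rw [hK0, zero_pow (Nat.succ_ne_zero n), zero_add] at h1
      rw [h1, ← intervalIntegral.integral_div, ← intervalIntegral.integral_const_mul]
      refine intervalIntegral.integral_congr fun t _ => ?_
      have := Nat.factorial_ne_zero n
      simp only [Nat.factorial_succ, Nat.cast_mul, Nat.cast_add, Nat.cast_one]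
      field_simp
    have hmaj : ∀ t ∈ Set.Ioc 0 |x|, ‖((c.op μ ^ n) F).1 t‖ ≤ ‖F‖ * (K t ^ n / n.factorial) ∧
        ‖((c.op μ ^ n) F).2 t‖ ≤ ‖F‖ * (K t ^ n / n.factorial) := fun t ht => by
      have := ih t
      rwa [abs_of_pos ht.1] at this
    rw [pow_succ', mul_apply_eq_comp, op_fst, op_snd, ← hval]
    constructor
    · refine intervalIntegral.norm_integral_le_of_norm_le (abs_nonneg x)
        (Eventually.of_forall fun t ht => ?_) hint
      obtain ⟨h1, h2⟩ := hmaj t ht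
      set B := ‖F‖ * (K t ^ n / n.factorial)
      have hB : 0 ≤ B := (norm_nonneg _).trans h1
      calc _ ≤ ‖c.s t‖ * ‖((c.op μ ^ n) F).1 t‖ + ‖c.one t‖ * ‖((c.op μ ^ n) F).2 t‖ := by
            refine (norm_add_le _ _).trans ?_
            rw [norm_mul, norm_mul]
        _ ≤ ‖c.s t‖ * B + ‖c.one t‖ * B := by gcongr
        _ ≤ c.maj μ t * B := by
            rw [← add_mul]; gcongr; unfold maj
            linarith [norm_nonneg (c.sq t), norm_nonneg (2 * μ * c.q t - μ ^ 2 * c.one t)]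
    · refine intervalIntegral.norm_integral_le_of_norm_le (abs_nonneg x)
        (Eventually.of_forall fun t ht => ?_) hint
      obtain ⟨h1, h2⟩ := hmaj t ht
      set B := ‖F‖ * (K t ^ n / n.factorial)
      have hB : 0 ≤ B := (norm_nonneg _).trans h1
      calc _ ≤ ‖c.s t‖ * ‖((c.op μ ^ n) F).2 t‖ + ‖c.sq t‖ * ‖((c.op μ ^ n) F).1 t‖ +
            ‖2 * μ * c.q t - μ ^ 2 * c.one t‖ * ‖((c.op μ ^ n) F).1 t‖ := by
            refine (norm_add_le _ _).trans (add_le_add ((norm_sub_le _ _).trans ?_) ?_)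
            · rw [norm_mul, norm_mul, norm_neg]
            · rw [norm_mul]
        _ ≤ ‖c.s t‖ * B + ‖c.sq t‖ * B + ‖2 * μ * c.q t - μ ^ 2 * c.one t‖ * B := by gcongr
        _ ≤ c.maj μ t * B := by
            rw [← add_mul, ← add_mul]; gcongr; unfold maj
            linarith [norm_nonneg (c.one t)]

/-- The operator is quasi-nilpotent, hence `1 - op μ` is invertible. -/
lemma isUnit_one_sub_op (μ : ℂ) : IsUnit (1 - c.op μ) := by
  set k : ℝ := ∫ t, c.maj μ t with hk
  have hk0 : 0 ≤ k := integral_nonneg (c.maj_nonneg μ)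
  have hK : ∀ x : ℝ, 0 ≤ ∫ t in (0 : ℝ)..|x|, c.maj μ t := fun x =>
    intervalIntegral.integral_nonneg (abs_nonneg x) fun t _ => c.maj_nonneg μ t
  have hKk : ∀ x : ℝ, ∫ t in (0 : ℝ)..|x|, c.maj μ t ≤ k := fun x => by
    rw [intervalIntegral.integral_of_le (abs_nonneg x)]
    exact setIntegral_le_integral (c.integrable_maj μ) (Eventually.of_forall (c.maj_nonneg μ))
  have hb : ∀ n : ℕ, ‖c.op μ ^ n‖ ≤ k ^ n / n.factorial := fun n => by
    refine ContinuousLinearMap.opNorm_le_bound _ (by positivity) fun F => ?_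
    have h2 : ∀ x, ‖F‖ * ((∫ t in (0 : ℝ)..|x|, c.maj μ t) ^ n / n.factorial) ≤
        k ^ n / n.factorial * ‖F‖ := fun x => by
      rw [mul_comm]
      gcongr
      exacts [hK x, hKk x]
    refine norm_prod_le_iff.2 ⟨?_, ?_⟩
    · exact (BoundedContinuousFunction.norm_le (by positivity)).2 fun x =>
        (c.norm_op_pow_apply_le μ F n x).1.trans (h2 x)
    · exact (BoundedContinuousFunction.norm_le (by positivity)).2 fun x =>
        (c.norm_op_pow_apply_le μ F n x).2.trans (h2 x)
  obtain ⟨n, hn⟩ := ((FloorSemiring.tendsto_pow_div_factorial_atTop k).eventually_lt_const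
    one_pos).exists
  exact isUnit_one_sub_of_norm_pow_lt_one _ n ((hb n).trans_lt hn)

/-- The solution of the integral equation with the constant initial pair `F₀`. -/
noncomputable def soln (F₀ : Pair) (μ : ℂ) : Pair := Ring.inverse (1 - c.op μ) F₀

lemma differentiable_soln (F₀ : Pair) : Differentiable ℂ (c.soln F₀) :=
  differentiable_inverse_one_sub_quadratic _ _ _ c.isUnit_one_sub_op F₀

lemma soln_eq (F₀ : Pair) (μ : ℂ) : c.soln F₀ μ = F₀ + c.op μ (c.soln F₀ μ) := by
  have h := congrArg (fun T : Pair →L[ℂ] Pair => T F₀)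
    (Ring.mul_inverse_cancel _ (c.isUnit_one_sub_op μ))
  simp only [mul_apply_eq_comp, one_apply_eq_self,
    sub_apply] at h
  exact sub_eq_iff_eq_add.1 h

end Coeffs

section Existence

variable {s q : ℝ → ℂ}

lemma integrableOn_of_memLp_two (hs : MemLp s 2 (volume.restrict (Set.Ioo 0 Real.pi))) :
    IntegrableOn s (Set.Ioo 0 Real.pi) :=
  hs.integrable (by norm_num)

lemma integrableOn_sq_of_memLp_two (hs : MemLp s 2 (volume.restrict (Set.Ioo 0 Real.pi))) :
    IntegrableOn (fun x => s x ^ 2) (Set.Ioo 0 Real.pi) := by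
  simpa [pow_two] using! hs.integrable_mul hs

/-- The coefficients of the pencil, extended by zero to the line. -/
noncomputable def Coeffs.ofFun (s q : ℝ → ℂ) (hs : MemLp s 2 (volume.restrict (Set.Ioo 0 Real.pi)))
    (hq : MemLp q 2 (volume.restrict (Set.Ioo 0 Real.pi))) : Coeffs where
  s := (Set.Ioo 0 Real.pi).indicator s
  one := (Set.Ioo 0 Real.pi).indicator 1
  sq := (Set.Ioo 0 Real.pi).indicator (fun x => s x ^ 2)
  q := (Set.Ioo 0 Real.pi).indicator q
  hs := (integrable_indicator_iff measurableSet_Ioo).2 (integrableOn_of_memLp_two hs)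
  hone := (integrable_indicator_iff measurableSet_Ioo).2 (integrableOn_const (by simp) (by simp))
  hsq := (integrable_indicator_iff measurableSet_Ioo).2 (integrableOn_sq_of_memLp_two hs)
  hq := (integrable_indicator_iff measurableSet_Ioo).2 (integrableOn_of_memLp_two hq)

/-- The size of a solution is controlled by its Cauchy data, uniformly on `[0, π]`. -/
lemma exists_norm_le_of_sol (hs : MemLp s 2 (volume.restrict (Set.Ioo 0 Real.pi)))
    (hq : MemLp q 2 (volume.restrict (Set.Ioo 0 Real.pi))) :
    ∃ A : ℝ, 0 ≤ A ∧ ∀ (μ : ℂ) (y y1 : ℝ → ℂ), Sol s q μ y y1 → ∀ x ∈ Set.Icc 0 Real.pi,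
      ‖y x‖ + ‖y1 x‖ ≤ (‖y 0‖ + ‖y1 0‖) * Real.exp (A * (1 + ‖μ‖) ^ 2) := by
  set k : ℝ → ℝ := fun t => 1 + ‖s t‖ + ‖s t ^ 2‖ + 2 * ‖q t‖ with hk
  have hk0 : ∀ t, 0 ≤ k t := fun t => by simp only [hk]; positivity
  have hki : IntervalIntegrable k volume 0 Real.pi := by
    rw [intervalIntegrable_iff_integrableOn_Ioo_of_le Real.pi_pos.le]
    exact (((integrableOn_const (by simp) (by simp)).add (integrableOn_of_memLp_two hs).norm).add
      (integrableOn_sq_of_memLp_two hs).norm).add ((integrableOn_of_memLp_two hq).norm.const_mul 2)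
  refine ⟨∫ t in (0 : ℝ)..Real.pi, k t, intervalIntegral.integral_nonneg Real.pi_pos.le
    fun t _ => hk0 t, fun μ y y1 h x hx => ?_⟩
  have hcy := h.fst.continuousOn Real.pi_pos.le
  have hcy1 := h.snd.continuousOn Real.pi_pos.le
  have hgi : IntervalIntegrable (fun t => k t * (1 + ‖μ‖) ^ 2) volume 0 Real.pi := hki.mul_const _
  have hsub : ∀ {z}, z ∈ Set.Icc 0 Real.pi → Set.uIcc 0 z ⊆ Set.uIcc 0 Real.pi := fun hz => by
    rw [Set.uIcc_of_le hz.1, Set.uIcc_of_le Real.pi_pos.le]; exact Set.Icc_subset_Icc_right hz.2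
  have key := gronwall_integral (f := fun t => ‖y t‖ + ‖y1 t‖) (c := ‖y 0‖ + ‖y1 0‖)
    Real.pi_pos.le (hcy.norm.add hcy1.norm)
    (fun t => mul_nonneg (hk0 t) (by positivity)) hgi ?_ x hx
  · refine key.trans ?_
    rw [intervalIntegral.integral_mul_const]
    gcongr
    refine intervalIntegral.integral_mono_interval le_rfl hx.1 hx.2 (Eventually.of_forall hk0) hki
  · intro z hz
    have e1 := h.fst.eq_integral hz
    have e2 := h.snd.eq_integral hz
    have i1 := (h.fst.intervalIntegrable Real.pi_pos.le).mono_set (hsub hz)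
    have i2 := (h.snd.intervalIntegrable Real.pi_pos.le).mono_set (hsub hz)
    have i3 : IntervalIntegrable (fun t => k t * (1 + ‖μ‖) ^ 2 * (‖y t‖ + ‖y1 t‖)) volume 0 z := by
      refine (hgi.mono_set (hsub hz)).mul_continuousOn ?_
      rw [Set.uIcc_of_le hz.1]
      exact (hcy.norm.add hcy1.norm).mono (Set.Icc_subset_Icc_right hz.2)
    have b1 : ‖y z‖ ≤ ‖y 0‖ + ∫ t in (0 : ℝ)..z, ‖y1 t + s t * y t‖ := by
      rw [e1]
      exact (norm_add_le _ _).trans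
        (by gcongr; exact intervalIntegral.norm_integral_le_integral_norm hz.1)
    have b2 : ‖y1 z‖ ≤ ‖y1 0‖ + ∫ t in (0 : ℝ)..z,
        ‖-s t * y1 t - s t ^ 2 * y t + (2 * μ * q t - μ ^ 2) * y t‖ := by
      rw [e2]
      exact (norm_add_le _ _).trans
        (by gcongr; exact intervalIntegral.norm_integral_le_integral_norm hz.1)
    have b3 : (∫ t in (0 : ℝ)..z, ‖y1 t + s t * y t‖) + (∫ t in (0 : ℝ)..z,
        ‖-s t * y1 t - s t ^ 2 * y t + (2 * μ * q t - μ ^ 2) * y t‖) ≤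
        ∫ t in (0 : ℝ)..z, k t * (1 + ‖μ‖) ^ 2 * (‖y t‖ + ‖y1 t‖) := by
      rw [← intervalIntegral.integral_add i1.norm i2.norm]
      refine intervalIntegral.integral_mono_on hz.1 (i1.norm.add i2.norm) i3 fun t _ => ?_
      have c1 : ‖y1 t + s t * y t‖ ≤ ‖y1 t‖ + ‖s t‖ * ‖y t‖ := by
        rw [← norm_mul]; exact norm_add_le _ _
      have c2 : ‖-s t * y1 t - s t ^ 2 * y t + (2 * μ * q t - μ ^ 2) * y t‖ ≤
          ‖s t‖ * ‖y1 t‖ + ‖s t ^ 2‖ * ‖y t‖ + (2 * ‖μ‖ * ‖q t‖ + ‖μ‖ ^ 2) * ‖y t‖ := by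
        refine (norm_add_le _ _).trans (add_le_add ((norm_sub_le _ _).trans ?_) ?_)
        · rw [norm_mul, norm_mul, norm_neg]
        · rw [norm_mul]
          gcongr
          refine (norm_sub_le _ _).trans ?_
          simp
      have hm := norm_nonneg μ
      have hy := norm_nonneg (y t)
      have hy1 := norm_nonneg (y1 t)
      have c3 : 1 + ‖s t‖ + ‖s t ^ 2‖ + (2 * ‖μ‖ * ‖q t‖ + ‖μ‖ ^ 2) ≤ k t * (1 + ‖μ‖) ^ 2 := by
        simp only [hk]
        have := norm_nonneg (s t)
        have := norm_nonneg (s t ^ 2)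
        have := norm_nonneg (q t)
        have h1 : (1 : ℝ) ≤ (1 + ‖μ‖) ^ 2 := by nlinarith
        have h2 : ‖s t‖ ≤ ‖s t‖ * (1 + ‖μ‖) ^ 2 := le_mul_of_one_le_right (by positivity) h1
        have h3 : ‖s t ^ 2‖ ≤ ‖s t ^ 2‖ * (1 + ‖μ‖) ^ 2 := le_mul_of_one_le_right (by positivity) h1
        have h4 : 2 * ‖μ‖ * ‖q t‖ ≤ 2 * ‖q t‖ * (1 + ‖μ‖) ^ 2 := by
          have : ‖μ‖ ≤ (1 + ‖μ‖) ^ 2 := by nlinarith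
          nlinarith [mul_le_mul_of_nonneg_left this (norm_nonneg (q t))]
        nlinarith
      calc _ ≤ (1 + ‖s t‖ + ‖s t ^ 2‖ + (2 * ‖μ‖ * ‖q t‖ + ‖μ‖ ^ 2)) * (‖y t‖ + ‖y1 t‖) := by
            have p1 : 0 ≤ (‖s t ^ 2‖ + (2 * ‖μ‖ * ‖q t‖ + ‖μ‖ ^ 2)) * ‖y1 t‖ := by positivity
            nlinarith
        _ ≤ _ := by gcongr
    linarith

/-- For any Cauchy data there are solutions on `[0, π]` whose values are entire functions of the
spectral parameter of order at most two. -/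
lemma exists_entire_sol (hs : MemLp s 2 (volume.restrict (Set.Ioo 0 Real.pi)))
    (hq : MemLp q 2 (volume.restrict (Set.Ioo 0 Real.pi))) (c c1 : ℂ) :
    ∃ Y Y1 : ℂ → ℝ → ℂ, (∀ μ, Sol s q μ (Y μ) (Y1 μ)) ∧ (∀ μ, Y μ 0 = c) ∧ (∀ μ, Y1 μ 0 = c1) ∧
      (∀ x ∈ Set.Icc 0 Real.pi, Differentiable ℂ (fun μ => Y μ x) ∧
        Differentiable ℂ (fun μ => Y1 μ x)) ∧
      ∀ x ∈ Set.Icc 0 Real.pi, QuadGrowth (fun μ => Y μ x) ∧ QuadGrowth (fun μ => Y1 μ x) := by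
  set K := Coeffs.ofFun s q hs hq with hK
  set F₀ : Coeffs.Pair :=
    (BoundedContinuousFunction.const ℝ c, BoundedContinuousFunction.const ℝ c1)
    with hF
  set F := K.soln F₀ with hFdef
  have e1 : ∀ μ x, (F μ).1 x = c + ∫ t in (0 : ℝ)..|x|, (K.s t * (F μ).1 t + K.one t * (F μ).2 t) :=
    fun μ x => by
      rw [← K.op_fst μ]
      conv_lhs => rw [hFdef, K.soln_eq]
      rfl
  have e2 : ∀ μ x, (F μ).2 x = c1 + ∫ t in (0 : ℝ)..|x|, (-K.s t * (F μ).2 t - K.sq t * (F μ).1 t +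
      (2 * μ * K.q t - μ ^ 2 * K.one t) * (F μ).1 t) :=
    fun μ x => by
      rw [← K.op_snd μ]
      conv_lhs => rw [hFdef, K.soln_eq]
      rfl
  have hi : ∀ {a : ℝ → ℂ}, Integrable a → ∀ f : BoundedContinuousFunction ℝ ℂ,
      IntervalIntegrable (fun t => a t * f t) volume 0 Real.pi :=
    fun ha f => (Coeffs.integrable_mul ha f).intervalIntegrable
  have hsol : ∀ μ, Sol s q μ (F μ).1 (F μ).2 := fun μ => by
    constructor
    · have : ACDeriv (F μ).1 (fun t => K.s t * (F μ).1 t + K.one t * (F μ).2 t) 0 Real.pi := by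
        refine ACDeriv.of_integral Real.pi_pos.le ((hi K.hs _).add (hi K.hone _)) fun x hx => ?_
        rw [e1 μ x, e1 μ 0, abs_of_nonneg hx.1]
        simp
      refine this.congr_deriv (Eventually.of_forall fun t ht => ?_)
      simp [hK, Coeffs.ofFun, ht, add_comm]
    · have : ACDeriv (F μ).2 (fun t => -K.s t * (F μ).2 t - K.sq t * (F μ).1 t +
          (2 * μ * K.q t - μ ^ 2 * K.one t) * (F μ).1 t) 0 Real.pi := by
        refine ACDeriv.of_integral Real.pi_pos.le (((hi K.hs.neg _).sub (hi K.hsq _)).add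
          (hi ((K.hq.const_mul (2 * μ)).sub (K.hone.const_mul (μ ^ 2))) _)) fun x hx => ?_
        rw [e2 μ x, e2 μ 0, abs_of_nonneg hx.1]
        simp
      refine this.congr_deriv (Eventually.of_forall fun t ht => ?_)
      simp [hK, Coeffs.ofFun, ht]
  have h0 : ∀ μ, (F μ).1 0 = c := fun μ => by rw [e1]; simp
  have h01 : ∀ μ, (F μ).2 0 = c1 := fun μ => by rw [e2]; simp
  refine ⟨fun μ => (F μ).1, fun μ => (F μ).2, hsol, h0, h01, fun x _ => ⟨?_, ?_⟩, fun x hx => ?_⟩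
  · exact ((BoundedContinuousFunction.evalCLM ℂ x).comp
      (ContinuousLinearMap.fst ℂ _ _)).differentiable.comp (K.differentiable_soln F₀)
  · exact ((BoundedContinuousFunction.evalCLM ℂ x).comp
      (ContinuousLinearMap.snd ℂ _ _)).differentiable.comp (K.differentiable_soln F₀)
  · obtain ⟨A, hA, hb⟩ := exists_norm_le_of_sol hs hq
    have hb' : ∀ μ, ‖(F μ).1 x‖ + ‖(F μ).2 x‖ ≤
        (‖c‖ + ‖c1‖) * Real.exp (A * (1 + ‖μ‖) ^ 2) := fun μ => by
      have := hb μ _ _ (hsol μ) x hx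
      rwa [h0, h01] at this
    exact ⟨QuadGrowth.of_le hA (by positivity) (fun _ => le_rfl) fun μ =>
        (le_add_of_nonneg_right (norm_nonneg _)).trans (hb' μ),
      QuadGrowth.of_le hA (by positivity) (fun _ => le_rfl) fun μ =>
        (le_add_of_nonneg_left (norm_nonneg _)).trans (hb' μ)⟩

end Existence

/-! ### Exponential dichotomy for large imaginary part of the parameter -/

/-- Variation of constants, as an estimate. -/
lemma norm_le_of_variation_of_constants {U h : ℝ → ℂ} {c : ℂ} {x : ℝ} (hx : 0 ≤ x)
    (hU : ACDeriv U (fun t => c * U t + h t) 0 x) :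
    ‖U x‖ ≤ Real.exp (c.re * x) * ‖U 0‖ + ∫ t in (0 : ℝ)..x, Real.exp (c.re * (x - t)) * ‖h t‖ := by
  have hid : ACDeriv (fun t : ℝ => ∫ _ in (0 : ℝ)..t, (1 : ℂ)) (fun _ => 1) 0 x :=
    ACDeriv.primitive hx (by simp)
  have hE : ACDeriv (fun t => Complex.exp (-c * ∫ _ in (0 : ℝ)..t, (1 : ℂ)))
      (fun t => Complex.exp (-c * ∫ _ in (0 : ℝ)..t, (1 : ℂ)) * (-c * 1)) 0 x :=
    (hid.const_mul (-c)).comp Complex.contDiff_exp Complex.hasDerivAt_exp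
  have h1 := ((hE.mul hU).congr_deriv
    (g' := fun t => Complex.exp (-c * t) * h t) (Eventually.of_forall fun t _ => by
      simp; ring)).eq_integral (x := x) ⟨hx, le_rfl⟩
  simp only [intervalIntegral.integral_const, sub_zero, Complex.real_smul, mul_one,
    Complex.ofReal_zero, mul_zero, Complex.exp_zero, one_mul] at h1
  have h2 : U x = Complex.exp (c * x) * U 0 +
      ∫ t in (0 : ℝ)..x, Complex.exp (c * (x - t)) * h t := by
    have : U x = Complex.exp (c * x) * (Complex.exp (-c * x) * U x) := by
      rw [← mul_assoc, ← Complex.exp_add]; simp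
    rw [this, h1, mul_add, ← intervalIntegral.integral_const_mul]
    congr 1
    refine intervalIntegral.integral_congr fun t _ => ?_
    rw [← mul_assoc, ← Complex.exp_add]
    ring_nf
  rw [h2]
  refine (norm_add_le _ _).trans (add_le_add ?_ ?_)
  · rw [norm_mul, Complex.norm_exp]; simp
  · refine (intervalIntegral.norm_integral_le_integral_norm hx).trans (le_of_eq ?_)
    refine intervalIntegral.integral_congr fun t _ => ?_
    simp only [norm_mul, Complex.norm_exp]
    congr 2
    rw [← Complex.ofReal_sub]; simp

section Dichotomy

variable {ι : Type*} {l : Filter ι} {b : ℝ} {c : ι → ℂ} {U V α β γ δ : ι → ℝ → ℂ}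
  {δ₀ : ℝ → ℂ} {g : ℝ → ℝ} {ε : ι → ℝ}

/-- The hypotheses of the dichotomy lemma for one system `U' = (c + α) U + β V`, `V' = γ U + δ V`
on `[0, b]`: the coefficients are dominated by `g`, and `δ` is within `ε g` of `δ₀`. -/
structure DichotomySystem (b : ℝ) (c : ℂ) (U V α β γ δ δ₀ : ℝ → ℂ) (g : ℝ → ℝ) (ε : ℝ) : Prop where
  hU : ACDeriv U (fun t => c * U t + (α t * U t + β t * V t)) 0 b
  hV : ACDeriv V (fun t => γ t * U t + δ t * V t) 0 b
  hU0 : ‖U 0‖ ≤ 1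
  hV0 : V 0 = 1
  hα : ∀ t, ‖α t‖ ≤ g t
  hβ : ∀ t, ‖β t‖ ≤ g t
  hγ : ∀ t, ‖γ t‖ ≤ g t
  hδ : ∀ t, ‖δ t‖ ≤ g t
  hδ₀ : ∀ t, ‖δ t - δ₀ t‖ ≤ ε * g t

lemma uIcc_zero_subset {b x : ℝ} (hx : x ∈ Set.Icc 0 b) : Set.uIcc 0 x ⊆ Set.uIcc 0 b := by
  rw [Set.uIcc_of_le hx.1, Set.uIcc_of_le (hx.1.trans hx.2)]
  exact Set.Icc_subset_Icc_right hx.2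

lemma DichotomySystem.norm_fst_le {c : ℂ} {U V α β γ δ : ℝ → ℂ} {ε : ℝ}
    (D : DichotomySystem b c U V α β γ δ δ₀ g ε) (hg : IntervalIntegrable g volume 0 b)
    {x : ℝ} (hx : x ∈ Set.Icc 0 b) :
    ‖U x‖ ≤ Real.exp (c.re * x) +
      ∫ t in (0 : ℝ)..x, Real.exp (c.re * (x - t)) * (g t * (‖U t‖ + ‖V t‖)) := by
  have hUx := D.hU.mono le_rfl hx.1 hx.2
  refine (norm_le_of_variation_of_constants hx.1 hUx).trans (add_le_add ?_ ?_)
  · exact mul_le_of_le_one_right (Real.exp_pos _).le D.hU0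
  · have hcU := (D.hU.continuousOn (hx.1.trans hx.2)).mono (Set.Icc_subset_Icc_right hx.2)
    have hcV := (D.hV.continuousOn (hx.1.trans hx.2)).mono (Set.Icc_subset_Icc_right hx.2)
    have hgx := hg.mono_set (uIcc_zero_subset hx)
    have hi : IntervalIntegrable (fun t => α t * U t + β t * V t) volume 0 x := by
      have h1 := hUx.intervalIntegrable hx.1
      have h2 : IntervalIntegrable (fun t => c * U t) volume 0 x :=
        ContinuousOn.intervalIntegrable
        (continuousOn_const.mul (by rwa [Set.uIcc_of_le hx.1]))
      simpa using h1.sub h2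
    refine intervalIntegral.integral_mono_on hx.1 ?_ ?_ fun t _ => ?_
    · exact hi.norm.continuousOn_mul (by fun_prop)
    · refine (hgx.mul_continuousOn ?_).continuousOn_mul (by fun_prop)
      rw [Set.uIcc_of_le hx.1]; exact hcU.norm.add hcV.norm
    · gcongr
      refine (norm_add_le _ _).trans ?_
      rw [norm_mul, norm_mul, mul_add]
      gcongr
      exacts [D.hα t, D.hβ t]

/-- An a priori bound independent of `c`, as long as `Re c ≤ 0`. -/
lemma DichotomySystem.norm_add_le {c : ℂ} {U V α β γ δ : ℝ → ℂ} {ε : ℝ}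
    (D : DichotomySystem b c U V α β γ δ δ₀ g ε) (hg : IntervalIntegrable g volume 0 b)
    (hg0 : ∀ t, 0 ≤ g t) (hc : c.re ≤ 0) {x : ℝ} (hx : x ∈ Set.Icc 0 b) :
    ‖U x‖ + ‖V x‖ ≤ 2 * Real.exp (∫ t in (0 : ℝ)..b, 2 * g t) := by
  have hb := hx.1.trans hx.2
  have hcU := D.hU.continuousOn hb
  have hcV := D.hV.continuousOn hb
  have key := gronwall_integral (f := fun t => ‖U t‖ + ‖V t‖) (g := fun t => 2 * g t) (c := 2)
    hb (hcU.norm.add hcV.norm) (fun t => by have := hg0 t; positivity) (hg.const_mul 2)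
    (fun x hx => ?_) x hx
  · refine key.trans ?_
    gcongr
    exact intervalIntegral.integral_mono_interval le_rfl hx.1 hx.2
      (Eventually.of_forall fun t => by have := hg0 t; positivity) (hg.const_mul 2)
  · have hcU := hcU.mono (Set.Icc_subset_Icc_right hx.2)
    have hcV := hcV.mono (Set.Icc_subset_Icc_right hx.2)
    have hgx := hg.mono_set (uIcc_zero_subset hx)
    have hgN : IntervalIntegrable (fun t => g t * (‖U t‖ + ‖V t‖)) volume 0 x := by
      refine hgx.mul_continuousOn ?_
      rw [Set.uIcc_of_le hx.1]; exact hcU.norm.add hcV.norm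
    have h1 : ‖U x‖ ≤ 1 + ∫ t in (0 : ℝ)..x, g t * (‖U t‖ + ‖V t‖) := by
      refine (D.norm_fst_le hg hx).trans (add_le_add ?_ ?_)
      · exact Real.exp_le_one_iff.2 (mul_nonpos_of_nonpos_of_nonneg hc hx.1)
      · refine intervalIntegral.integral_mono_on hx.1 (hgN.continuousOn_mul (by fun_prop)) hgN
          fun t ht => ?_
        refine mul_le_of_le_one_left (mul_nonneg (hg0 t) (by positivity)) ?_
        exact Real.exp_le_one_iff.2 (mul_nonpos_of_nonpos_of_nonneg hc (by linarith [ht.2]))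
    have h2 : ‖V x‖ ≤ 1 + ∫ t in (0 : ℝ)..x, g t * (‖U t‖ + ‖V t‖) := by
      have hVx := D.hV.mono le_rfl hx.1 hx.2
      rw [hVx.eq_integral ⟨hx.1, le_rfl⟩, D.hV0]
      refine (_root_.norm_add_le _ _).trans (add_le_add (by simp) ?_)
      refine intervalIntegral.norm_integral_le_of_norm_le hx.1
        (Eventually.of_forall fun t _ => ?_) hgN
      refine (_root_.norm_add_le _ _).trans ?_
      rw [norm_mul, norm_mul, mul_add]
      gcongr
      exacts [D.hγ t, D.hδ t]
    simp only [mul_assoc, intervalIntegral.integral_const_mul]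
    linarith

/-- If `Re c → -∞`, the component `U` of the system dies out and `V` decouples from it. -/
lemma tendsto_of_dichotomySystem [l.IsCountablyGenerated] (hb : 0 < b)
    (hc : Tendsto (fun i => (c i).re) l atBot) (hg : IntervalIntegrable g volume 0 b)
    (hg0 : ∀ t, 0 ≤ g t) (hδ : IntervalIntegrable δ₀ volume 0 b) (hε : Tendsto ε l (𝓝 0))
    (D : ∀ᶠ i in l, DichotomySystem b (c i) (U i) (V i) (α i) (β i) (γ i) (δ i) δ₀ g (ε i)) :
    Tendsto (fun i => U i b) l (𝓝 0) ∧
      Tendsto (fun i => V i b) l (𝓝 (Complex.exp (∫ t in (0 : ℝ)..b, δ₀ t))) := by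
  set K : ℝ := 2 * Real.exp (∫ t in (0 : ℝ)..b, 2 * g t) with hK
  have hK0 : 0 ≤ K := by positivity
  have hcneg : ∀ᶠ i in l, (c i).re ≤ 0 := hc.eventually_le_atBot 0
  have hexp : ∀ r : ℝ, 0 < r → Tendsto (fun i => Real.exp ((c i).re * r)) l (𝓝 0) := fun r hr =>
    Real.tendsto_exp_atBot.comp (hc.atBot_mul_const hr)
  have hUlim : ∀ x ∈ Set.Ioc 0 b, Tendsto (fun i => U i x) l (𝓝 0) := by
    intro x hx
    have hx' : x ∈ Set.Icc 0 b := ⟨hx.1.le, hx.2⟩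
    have hgx := hg.mono_set (uIcc_zero_subset hx')
    have hdom : Tendsto (fun i => ∫ t in (0 : ℝ)..x, Real.exp ((c i).re * (x - t)) * (g t * K)) l
        (𝓝 (∫ t in (0 : ℝ)..x, 0)) := by
      refine intervalIntegral.tendsto_integral_filter_of_dominated_convergence (fun t => g t * K)
        (Eventually.of_forall fun i => ?_) ?_ (hgx.mul_const K) ?_
      · refine AEStronglyMeasurable.mul (Continuous.aestronglyMeasurable (by fun_prop)) ?_
        exact ((hgx.mul_const K).def').aestronglyMeasurable
      · filter_upwards [hcneg] with i hi
        refine Eventually.of_forall fun t ht => ?_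
        rw [Set.uIoc_of_le hx.1.le] at ht
        have : 0 ≤ g t * K := mul_nonneg (hg0 t) hK0
        rw [norm_mul, Real.norm_of_nonneg (Real.exp_pos _).le, Real.norm_of_nonneg this]
        refine mul_le_of_le_one_left this ?_
        exact Real.exp_le_one_iff.2 (mul_nonpos_of_nonpos_of_nonneg hi (by linarith [ht.2]))
      · have hne : ∀ᵐ t : ℝ, t ≠ x := by simp [ae_iff, measure_singleton]
        filter_upwards [hne] with t hne ht
        rw [Set.uIoc_of_le hx.1.le] at ht
        simpa using (hexp (x - t) (sub_pos.2 (lt_of_le_of_ne ht.2 hne))).mul_const (g t * K)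
    have hsum := (hexp x hx.1).add hdom
    simp only [intervalIntegral.integral_zero, add_zero] at hsum
    refine squeeze_zero_norm' ?_ hsum
    filter_upwards [D, hcneg] with i Di hi
    refine (Di.norm_fst_le hg hx').trans (add_le_add_right ?_ _)
    have hcU := (Di.hU.continuousOn hb.le).mono (Set.Icc_subset_Icc_right hx.2)
    have hcV := (Di.hV.continuousOn hb.le).mono (Set.Icc_subset_Icc_right hx.2)
    refine intervalIntegral.integral_mono_on hx.1.le ?_ ?_ fun t ht => ?_
    · refine (hgx.mul_continuousOn ?_).continuousOn_mul (by fun_prop)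
      rw [Set.uIcc_of_le hx.1.le]; exact hcU.norm.add hcV.norm
    · exact (hgx.mul_const K).continuousOn_mul (by fun_prop)
    · have := Di.norm_add_le hg hg0 hi (x := t) ⟨ht.1, ht.2.trans hx.2⟩
      have := hg0 t
      gcongr
  refine ⟨hUlim b ⟨hb, le_rfl⟩, ?_⟩
  have hE : ACDeriv (fun t => Complex.exp (-1 * ∫ r in (0 : ℝ)..t, δ₀ r))
      (fun t => Complex.exp (-1 * ∫ r in (0 : ℝ)..t, δ₀ r) * (-1 * δ₀ t)) 0 b :=
    ((ACDeriv.primitive hb.le hδ).const_mul (-1)).comp Complex.contDiff_exp Complex.hasDerivAt_exp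
  set e : ℝ → ℂ := fun t => Complex.exp (-1 * ∫ r in (0 : ℝ)..t, δ₀ r) with he
  obtain ⟨M, hM⟩ := hE.ac.exists_bound
  rw [Set.uIcc_of_le hb.le] at hM
  have hM0 : 0 ≤ M := (norm_nonneg _).trans (hM 0 ⟨le_rfl, hb.le⟩)
  have hdom : Tendsto (fun i => ∫ t in (0 : ℝ)..b, M * (g t * (‖U i t‖ + ε i * K))) l
      (𝓝 (∫ t in (0 : ℝ)..b, 0)) := by
    refine intervalIntegral.tendsto_integral_filter_of_dominated_convergence
      (fun t => M * (g t * (K + 1 * K))) ?_ ?_ ((hg.mul_const _).const_mul M) ?_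
    · filter_upwards [D] with i Di
      refine ((AEStronglyMeasurable.mul hg.def'.aestronglyMeasurable ?_).const_mul M)
      refine AEStronglyMeasurable.add_const (ContinuousOn.aestronglyMeasurable ?_
        measurableSet_uIoc) _
      rw [Set.uIoc_of_le hb.le]
      exact (Di.hU.continuousOn hb.le).norm.mono Set.Ioc_subset_Icc_self
    · filter_upwards [D, hcneg, hε.eventually_le_const (zero_lt_one),
        hε.eventually_const_le (show (-1 : ℝ) < 0 by norm_num)] with i Di hi hε1 hε2
      refine Eventually.of_forall fun t ht => ?_
      rw [Set.uIoc_of_le hb.le] at ht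
      have h1 := Di.norm_add_le hg hg0 hi (x := t) ⟨ht.1.le, ht.2⟩
      have h2 := norm_nonneg (V i t)
      rw [norm_mul, norm_mul, Real.norm_of_nonneg hM0, Real.norm_of_nonneg (hg0 t)]
      refine mul_le_mul_of_nonneg_left (mul_le_mul_of_nonneg_left ?_ (hg0 t)) hM0
      refine (_root_.norm_add_le _ _).trans (add_le_add (by rw [norm_norm]; linarith) ?_)
      rw [norm_mul, Real.norm_of_nonneg hK0]
      exact mul_le_mul_of_nonneg_right (abs_le.2 ⟨hε2, hε1⟩) hK0
    · refine Eventually.of_forall fun t ht => ?_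
      rw [Set.uIoc_of_le hb.le] at ht
      have := (((hUlim t ht).norm.add (hε.mul_const K)).const_mul (g t)).const_mul M
      simpa using this
  simp only [intervalIntegral.integral_zero] at hdom
  have hlim : Tendsto (fun i => e b * V i b - 1) l (𝓝 0) := by
    refine squeeze_zero_norm' ?_ hdom
    filter_upwards [D, hcneg] with i Di hi
    have h1 := ((hE.mul Di.hV).congr_deriv (g' := fun t => e t * (γ i t * U i t +
      (δ i t - δ₀ t) * V i t)) (Eventually.of_forall fun t _ => by simp only [he]; ring))
    have h2 := h1.eq_integral (x := b) ⟨hb.le, le_rfl⟩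
    have he0 : e 0 = 1 := by simp [he]
    simp only [Di.hV0, he0, mul_one] at h2
    rw [show e b * V i b = _ from h2, add_sub_cancel_left]
    refine intervalIntegral.norm_integral_le_of_norm_le hb.le
      (Eventually.of_forall fun t ht => ?_) ?_
    · rw [norm_mul]
      have h3 := Di.norm_add_le hg hg0 hi (x := t) ⟨ht.1.le, ht.2⟩
      have h4 : ‖V i t‖ ≤ K := by linarith [norm_nonneg (U i t)]
      have h5 : 0 ≤ ε i * g t := (norm_nonneg _).trans (Di.hδ₀ t)
      refine mul_le_mul (hM t ⟨ht.1.le, ht.2⟩) ?_ (norm_nonneg _) hM0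
      refine (_root_.norm_add_le _ _).trans ?_
      rw [norm_mul, norm_mul, mul_add]
      calc _ ≤ g t * ‖U i t‖ + (ε i * g t) * K := by
            gcongr
            exacts [Di.hγ t, Di.hδ₀ t]
        _ = _ := by ring
    · refine (hg.mul_continuousOn (ContinuousOn.add ?_ continuousOn_const)).const_mul M
      rw [Set.uIcc_of_le hb.le]
      exact (Di.hU.continuousOn hb.le).norm
  have h6 := ((hlim.add_const 1).const_mul (Complex.exp (∫ t in (0 : ℝ)..b, δ₀ t)))
  simp only [sub_add_cancel, zero_add, mul_one] at h6
  refine h6.congr fun i => ?_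
  rw [he, ← mul_assoc, ← Complex.exp_add]
  simp

end Dichotomy

/-! ### Asymptotics of the solutions far from the real axis -/

/-- The filter of complex numbers whose imaginary part tends to `+∞`. -/
noncomputable abbrev upper : Filter ℂ := comap Complex.im atTop

lemma tendsto_norm_upper : Tendsto (fun μ : ℂ => ‖μ‖) upper atTop :=
  tendsto_atTop_mono (fun μ => (le_abs_self _).trans (Complex.abs_im_le_norm μ)) tendsto_comap

instance : upper.NeBot := by
  refine comap_neBot_iff_frequently.2 (Eventually.frequently (Eventually.of_forall fun r => ?_))
  exact ⟨⟨0, r⟩, rfl⟩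

lemma eventually_upper_ne_zero : ∀ᶠ μ in upper, μ ≠ 0 := by
  filter_upwards [tendsto_norm_upper.eventually_ge_atTop 1] with μ h
  exact norm_pos_iff.1 (one_pos.trans_le h)

section Asymptotics

variable {s q : ℝ → ℂ}

/-- The components of a solution in the eigenbasis of the leading part, normalized by the growing
exponential, satisfy the hypotheses of the dichotomy lemma. -/
lemma Sol.dichotomySystem {μ : ℂ} {y y1 : ℝ → ℂ} (h : Sol s q μ y y1) (hy : y 0 = 0)
    (hy1 : y1 0 = 1) (hμ : 1 ≤ ‖μ‖) {x : ℝ} (hx : x ∈ Set.Ioc 0 Real.pi) :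
    DichotomySystem x (2 * Complex.I * μ)
      (fun t => -1 * (Complex.I * μ * y t + y1 t) * Complex.exp (Complex.I * μ * t))
      (fun t => (-(Complex.I * μ) * y t + y1 t) * Complex.exp (Complex.I * μ * t))
      (fun t => Complex.I * s t ^ 2 / (2 * μ) - Complex.I * q t)
      (fun t => s t + (Complex.I * s t ^ 2 / (2 * μ) - Complex.I * q t))
      (fun t => s t - (Complex.I * s t ^ 2 / (2 * μ) - Complex.I * q t))
      (fun t => Complex.I * q t - Complex.I * s t ^ 2 / (2 * μ))
      (fun t => Complex.I * q t) (fun t => ‖s t‖ + ‖s t‖ ^ 2 + ‖q t‖) ‖μ‖⁻¹ := by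
  have hμ0 : μ ≠ 0 := norm_pos_iff.1 (one_pos.trans_le hμ)
  have hfst := h.fst.mono le_rfl hx.1.le hx.2
  have hsnd := h.snd.mono le_rfl hx.1.le hx.2
  have hid : ACDeriv (fun t : ℝ => (t : ℂ)) (fun _ => 1) 0 x :=
    ACDeriv.of_integral hx.1.le (by simp) (by simp)
  have hE : ACDeriv (fun t : ℝ => Complex.exp (Complex.I * μ * t))
      (fun t => Complex.exp (Complex.I * μ * t) * (Complex.I * μ * 1)) 0 x :=
    (hid.const_mul (Complex.I * μ)).comp Complex.contDiff_exp Complex.hasDerivAt_exp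
  have hκ : ∀ t, ‖Complex.I * s t ^ 2 / (2 * μ)‖ ≤ ‖μ‖⁻¹ * ‖s t‖ ^ 2 := fun t => by
    simp only [norm_div, norm_mul, Complex.norm_I, one_mul, norm_pow, Complex.norm_ofNat]
    rw [div_eq_inv_mul, mul_inv]
    have : 0 ≤ ‖μ‖⁻¹ * ‖s t‖ ^ 2 := by positivity
    nlinarith
  have hκ' : ∀ t, ‖Complex.I * s t ^ 2 / (2 * μ)‖ ≤ ‖s t‖ ^ 2 := fun t =>
    (hκ t).trans (mul_le_of_le_one_left (by positivity) (inv_le_one_of_one_le₀ hμ))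
  have hq : ∀ t, ‖Complex.I * q t‖ = ‖q t‖ := fun t => by simp
  refine ⟨?_, ?_, ?_, ?_, fun t => ?_, fun t => ?_, fun t => ?_, fun t => ?_, fun t => ?_⟩
  · refine ((((hfst.const_mul (Complex.I * μ)).add hsnd).const_mul (-1)).mul hE).congr_deriv
      (Eventually.of_forall fun t _ => ?_)
    field_simp
    ring_nf
    simp only [Complex.I_sq]
    ring
  · refine (((hfst.const_mul (-(Complex.I * μ))).add hsnd).mul hE).congr_deriv
      (Eventually.of_forall fun t _ => ?_)
    field_simp
    ring_nf
    simp only [Complex.I_sq]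
    ring
  · simp [hy, hy1]
  · simp [hy, hy1]
  · refine (norm_sub_le _ _).trans ?_
    rw [hq]; linarith [hκ' t, norm_nonneg (s t)]
  · refine (norm_add_le _ _).trans ?_
    have := norm_sub_le (Complex.I * s t ^ 2 / (2 * μ)) (Complex.I * q t)
    rw [hq] at this; linarith [hκ' t]
  · refine (norm_sub_le _ _).trans ?_
    have := norm_sub_le (Complex.I * s t ^ 2 / (2 * μ)) (Complex.I * q t)
    rw [hq] at this; linarith [hκ' t]
  · refine (norm_sub_le _ _).trans ?_
    rw [hq]; linarith [hκ' t, norm_nonneg (s t)]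
  · rw [sub_sub_cancel_left, norm_neg]
    refine (hκ t).trans ?_
    gcongr
    linarith [norm_nonneg (s t), norm_nonneg (q t)]

variable (hs : MemLp s 2 (volume.restrict (Set.Ioo 0 Real.pi)))
  (hq : MemLp q 2 (volume.restrict (Set.Ioo 0 Real.pi)))
  {Y Y1 : ℂ → ℝ → ℂ} (h : ∀ μ, Sol s q μ (Y μ) (Y1 μ)) (h0 : ∀ μ, Y μ 0 = 0)
  (h1 : ∀ μ, Y1 μ 0 = 1) {x : ℝ} (hx : x ∈ Set.Ioc 0 Real.pi)

lemma intervalIntegrable_of_memLp_two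
    (hs : MemLp s 2 (volume.restrict (Set.Ioo 0 Real.pi))) :
    IntervalIntegrable s volume 0 Real.pi := by
  rw [intervalIntegrable_iff_integrableOn_Ioo_of_le Real.pi_pos.le]
  exact integrableOn_of_memLp_two hs

include hs hq h h0 h1 hx

lemma tendsto_sol_components :
    Tendsto (fun μ => -1 * (Complex.I * μ * Y μ x + Y1 μ x) * Complex.exp (Complex.I * μ * x)) upper
      (𝓝 0) ∧
    Tendsto (fun μ => (-(Complex.I * μ) * Y μ x + Y1 μ x) * Complex.exp (Complex.I * μ * x)) upper
      (𝓝 (Complex.exp (∫ t in (0 : ℝ)..x, Complex.I * q t))) := by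
  have hsub : Set.uIcc 0 x ⊆ Set.uIcc 0 Real.pi := uIcc_zero_subset ⟨hx.1.le, hx.2⟩
  refine tendsto_of_dichotomySystem (b := x) (c := fun μ => 2 * Complex.I * μ)
    (δ₀ := fun t => Complex.I * q t) (g := fun t => ‖s t‖ + ‖s t‖ ^ 2 + ‖q t‖)
    (ε := fun μ : ℂ => ‖μ‖⁻¹)
    (U := fun μ t => -1 * (Complex.I * μ * Y μ t + Y1 μ t) * Complex.exp (Complex.I * μ * t))
    (V := fun μ t => (-(Complex.I * μ) * Y μ t + Y1 μ t) * Complex.exp (Complex.I * μ * t))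
    (α := fun μ t => Complex.I * s t ^ 2 / (2 * μ) - Complex.I * q t)
    (β := fun μ t => s t + (Complex.I * s t ^ 2 / (2 * μ) - Complex.I * q t))
    (γ := fun μ t => s t - (Complex.I * s t ^ 2 / (2 * μ) - Complex.I * q t))
    (δ := fun μ t => Complex.I * q t - Complex.I * s t ^ 2 / (2 * μ))
    hx.1 ?_ ?_ (fun t => by positivity) ?_ tendsto_norm_upper.inv_tendsto_atTop ?_
  · have : (fun μ : ℂ => (2 * Complex.I * μ).re) = fun μ => (-2) * μ.im := by
      ext μ; simp
    rw [this]
    exact tendsto_comap.const_mul_atTop_of_neg (by norm_num)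
  · have h2 : IntervalIntegrable (fun t => ‖s t‖ ^ 2) volume 0 Real.pi := by
      rw [intervalIntegrable_iff_integrableOn_Ioo_of_le Real.pi_pos.le]
      simpa using! (integrableOn_sq_of_memLp_two hs).norm
    exact (((intervalIntegrable_of_memLp_two hs).norm.add h2).add
      (intervalIntegrable_of_memLp_two hq).norm).mono_set hsub
  · exact ((intervalIntegrable_of_memLp_two hq).const_mul _).mono_set hsub
  · filter_upwards [tendsto_norm_upper.eventually_ge_atTop 1] with μ hμ
    exact (h μ).dichotomySystem (h0 μ) (h1 μ) hμ hx

/-- The growth of the solution with `y(0) = 0`, `y^{[1]}(0) = 1` as `Im μ → +∞`. -/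
lemma tendsto_sol :
    Tendsto (fun μ => -2 * Complex.I * μ * Complex.exp (Complex.I * μ * x) * Y μ x) upper
      (𝓝 (Complex.exp (∫ t in (0 : ℝ)..x, Complex.I * q t))) := by
  obtain ⟨hU, hV⟩ := tendsto_sol_components hs hq h h0 h1 hx
  have := hU.add hV
  rw [zero_add] at this
  refine this.congr fun μ => ?_
  ring

lemma eventually_sol_ne_zero : ∀ᶠ μ in upper, Y μ x ≠ 0 := by
  filter_upwards [(tendsto_sol hs hq h h0 h1 hx).eventually_ne (Complex.exp_ne_zero _)] with μ hμ h
  exact hμ (by rw [h, mul_zero])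

/-- The Weyl function of the interval `[0, x]` is asymptotically `-i μ` as `Im μ → +∞`. -/
lemma tendsto_logDeriv_sol :
    Tendsto (fun μ => Y1 μ x / (μ * Y μ x)) upper (𝓝 (-Complex.I)) := by
  obtain ⟨hU, hV⟩ := tendsto_sol_components hs hq h h0 h1 hx
  have hne := Complex.exp_ne_zero (∫ t in (0 : ℝ)..x, Complex.I * q t)
  have := ((hV.sub hU).div (hU.add hV) (by simp)).const_mul (-Complex.I)
  simp only [sub_zero, zero_add, div_self hne, mul_one] at this
  refine this.congr' ?_
  filter_upwards [eventually_sol_ne_zero hs hq h h0 h1 hx, eventually_upper_ne_zero] with μ hy hμ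
  have e1 := Complex.exp_ne_zero (Complex.I * μ * x)
  have hI := Complex.I_ne_zero
  have a1 : (-(Complex.I * μ) * Y μ x + Y1 μ x) * Complex.exp (Complex.I * μ * x) -
      -1 * (Complex.I * μ * Y μ x + Y1 μ x) * Complex.exp (Complex.I * μ * x) =
      2 * Y1 μ x * Complex.exp (Complex.I * μ * x) := by ring
  have a2 : -1 * (Complex.I * μ * Y μ x + Y1 μ x) * Complex.exp (Complex.I * μ * x) +
      (-(Complex.I * μ) * Y μ x + Y1 μ x) * Complex.exp (Complex.I * μ * x) =
      -2 * Complex.I * μ * Y μ x * Complex.exp (Complex.I * μ * x) := by ring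
  simp only [Pi.div_apply]
  rw [a1, a2]
  field_simp

end Asymptotics

/-! ### Fundamental systems -/

/-- A fundamental system `S`, `C` with `S(0) = 0`, `S^{[1]}(0) = 1`, `C(0) = 1`, `C^{[1]}(0) = 0`,
depending on the spectral parameter as entire functions of order at most two. -/
structure Fundamental (s q : ℝ → ℂ) (S S1 C C1 : ℂ → ℝ → ℂ) : Prop where
  hs : MemLp s 2 (volume.restrict (Set.Ioo 0 Real.pi))
  hq : MemLp q 2 (volume.restrict (Set.Ioo 0 Real.pi))
  solS : ∀ μ, Sol s q μ (S μ) (S1 μ)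
  solC : ∀ μ, Sol s q μ (C μ) (C1 μ)
  S0 : ∀ μ, S μ 0 = 0
  S10 : ∀ μ, S1 μ 0 = 1
  C0 : ∀ μ, C μ 0 = 1
  C10 : ∀ μ, C1 μ 0 = 0
  diffS : ∀ x ∈ Set.Icc 0 Real.pi, Differentiable ℂ (fun μ => S μ x)
  diffS1 : ∀ x ∈ Set.Icc 0 Real.pi, Differentiable ℂ (fun μ => S1 μ x)
  diffC : ∀ x ∈ Set.Icc 0 Real.pi, Differentiable ℂ (fun μ => C μ x)
  diffC1 : ∀ x ∈ Set.Icc 0 Real.pi, Differentiable ℂ (fun μ => C1 μ x)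
  growthS : ∀ x ∈ Set.Icc 0 Real.pi, QuadGrowth (fun μ => S μ x)
  growthS1 : ∀ x ∈ Set.Icc 0 Real.pi, QuadGrowth (fun μ => S1 μ x)
  growthC : ∀ x ∈ Set.Icc 0 Real.pi, QuadGrowth (fun μ => C μ x)
  growthC1 : ∀ x ∈ Set.Icc 0 Real.pi, QuadGrowth (fun μ => C1 μ x)

lemma exists_fundamental {s q : ℝ → ℂ} (hs : MemLp s 2 (volume.restrict (Set.Ioo 0 Real.pi)))
    (hq : MemLp q 2 (volume.restrict (Set.Ioo 0 Real.pi))) :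
    ∃ S S1 C C1 : ℂ → ℝ → ℂ, Fundamental s q S S1 C C1 := by
  obtain ⟨S, S1, a1, a2, a3, a4, a5⟩ := exists_entire_sol hs hq 0 1
  obtain ⟨C, C1, b1, b2, b3, b4, b5⟩ := exists_entire_sol hs hq 1 0
  exact ⟨S, S1, C, C1, hs, hq, a1, b1, a2, a3, b2, b3, fun x hx => (a4 x hx).1,
    fun x hx => (a4 x hx).2, fun x hx => (b4 x hx).1, fun x hx => (b4 x hx).2,
    fun x hx => (a5 x hx).1, fun x hx => (a5 x hx).2, fun x hx => (b5 x hx).1,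
    fun x hx => (b5 x hx).2⟩

lemma QuadGrowth.comp_neg {f : ℂ → ℂ} (hf : QuadGrowth f) : QuadGrowth (fun μ => f (-μ)) := by
  obtain ⟨A, hA, h⟩ := hf
  exact ⟨A, hA, fun μ => by simpa using h (-μ)⟩

lemma pi_mem : Real.pi ∈ Set.Icc 0 Real.pi := ⟨Real.pi_pos.le, le_rfl⟩

namespace Fundamental

variable {s q : ℝ → ℂ} {S S1 C C1 : ℂ → ℝ → ℂ} (F : Fundamental s q S S1 C C1)

include F

/-- Changing the sign of the spectral parameter and of `q₁` leaves the equation unchanged. -/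
lemma neg : Fundamental s (fun x => -q x) (fun μ => S (-μ)) (fun μ => S1 (-μ)) (fun μ => C (-μ))
    (fun μ => C1 (-μ)) where
  hs := F.hs
  hq := F.hq.neg
  solS μ := by simpa using (F.solS (-μ)).neg_param
  solC μ := by simpa using (F.solC (-μ)).neg_param
  S0 μ := F.S0 _
  S10 μ := F.S10 _
  C0 μ := F.C0 _
  C10 μ := F.C10 _
  diffS x hx := (F.diffS x hx).comp differentiable_neg
  diffS1 x hx := (F.diffS1 x hx).comp differentiable_neg
  diffC x hx := (F.diffC x hx).comp differentiable_neg
  diffC1 x hx := (F.diffC1 x hx).comp differentiable_neg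
  growthS x hx := (F.growthS x hx).comp_neg
  growthS1 x hx := (F.growthS1 x hx).comp_neg
  growthC x hx := (F.growthC x hx).comp_neg
  growthC1 x hx := (F.growthC1 x hx).comp_neg

lemma wronskian_eq_one (μ : ℂ) {x : ℝ} (hx : x ∈ Set.Icc 0 Real.pi) :
    S1 μ x * C μ x - S μ x * C1 μ x = 1 := by
  rw [(F.solS μ).wronskian (F.solC μ) hx, F.S0, F.S10, F.C0, F.C10]; ring

lemma tendsto_S {x : ℝ} (hx : x ∈ Set.Ioc 0 Real.pi) :
    Tendsto (fun μ => -2 * Complex.I * μ * Complex.exp (Complex.I * μ * x) * S μ x) upper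
      (𝓝 (Complex.exp (∫ t in (0 : ℝ)..x, Complex.I * q t))) :=
  tendsto_sol F.hs F.hq F.solS F.S0 F.S10 hx

lemma eventually_S_ne_zero {x : ℝ} (hx : x ∈ Set.Ioc 0 Real.pi) : ∀ᶠ μ in upper, S μ x ≠ 0 :=
  eventually_sol_ne_zero F.hs F.hq F.solS F.S0 F.S10 hx

lemma tendsto_logDeriv_S {x : ℝ} (hx : x ∈ Set.Ioc 0 Real.pi) :
    Tendsto (fun μ => S1 μ x / (μ * S μ x)) upper (𝓝 (-Complex.I)) :=
  tendsto_logDeriv_sol F.hs F.hq F.solS F.S0 F.S10 hx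

/-- The solution `S(π) C - C(π) S` vanishes at `π`, with quasi-derivative `-1` there: its reflection
is the solution `S` of the reflected problem. -/
lemma sol_psi (μ : ℂ) : Sol s q μ (fun x => S μ Real.pi * C μ x + -C μ Real.pi * S μ x)
    (fun x => S μ Real.pi * C1 μ x + -C μ Real.pi * S1 μ x) :=
  (F.solC μ).comb (F.solS μ) _ _

omit F in
lemma memLp_reflect {f : ℝ → ℂ} (hf : MemLp f 2 (volume.restrict (Set.Ioo 0 Real.pi))) :
    MemLp (fun x => f (Real.pi - x)) 2 (volume.restrict (Set.Ioo 0 Real.pi)) := by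
  have h := (Measure.measurePreserving_sub_left (volume : Measure ℝ) Real.pi).restrict_preimage
    (s := Set.Ioo 0 Real.pi) measurableSet_Ioo
  have e : (fun x => Real.pi - x) ⁻¹' Set.Ioo 0 Real.pi = Set.Ioo 0 Real.pi := by
    rw [Set.preimage_const_sub_Ioo]; simp
  rw [e] at h
  exact hf.comp_measurePreserving h

/-- The asymptotics of the solution vanishing at `π`, obtained from `tendsto_logDeriv_sol` by
reversing the interval. -/
lemma tendsto_psi {x : ℝ} (hx : x ∈ Set.Ico 0 Real.pi) :
    (∀ᶠ μ in upper, S μ Real.pi * C μ x + -C μ Real.pi * S μ x ≠ 0) ∧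
    Tendsto (fun μ => (S μ Real.pi * C1 μ x + -C μ Real.pi * S1 μ x) /
      (μ * (S μ Real.pi * C μ x + -C μ Real.pi * S μ x))) upper (𝓝 Complex.I) := by
  have hr := fun μ => (F.sol_psi μ).reflect
  have hs := (memLp_reflect F.hs).neg
  have hq := memLp_reflect F.hq
  have h0 : ∀ μ, S μ Real.pi * C μ (Real.pi - 0) + -C μ Real.pi * S μ (Real.pi - 0) = 0 :=
    fun μ => by rw [sub_zero]; ring
  have h1 : ∀ μ, -(S μ Real.pi * C1 μ (Real.pi - 0) + -C μ Real.pi * S1 μ (Real.pi - 0)) = 1 :=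
    fun μ => by
      rw [sub_zero]; linear_combination F.wronskian_eq_one μ pi_mem
  have hx' : Real.pi - x ∈ Set.Ioc 0 Real.pi := ⟨by linarith [hx.2], by linarith [hx.1]⟩
  have key1 := eventually_sol_ne_zero hs hq hr h0 h1 hx'
  have key2 := tendsto_logDeriv_sol hs hq hr h0 h1 hx'
  simp only [sub_sub_cancel] at key1 key2
  refine ⟨key1, ?_⟩
  have := key2.neg
  rw [neg_neg] at this
  exact this.congr fun μ => by rw [neg_div, neg_neg]

/-- The Weyl function is asymptotically `i μ` as `Im μ → +∞`. -/
lemma tendsto_weyl :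
    Tendsto (fun μ => -C μ Real.pi / (μ * S μ Real.pi)) upper (𝓝 Complex.I) := by
  refine (F.tendsto_psi (x := 0) ⟨le_rfl, Real.pi_pos⟩).2.congr fun μ => ?_
  rw [F.S0, F.S10, F.C0, F.C10]; ring

/-- The diagonal of Green's function tends to zero as `Im μ → +∞`. -/
lemma tendsto_green {x : ℝ} (hx : x ∈ Set.Ioo 0 Real.pi) :
    Tendsto (fun μ => (S μ Real.pi * C μ x + -C μ Real.pi * S μ x) * S μ x / S μ Real.pi) upper
      (𝓝 0) := by
  have hxo : x ∈ Set.Ioc 0 Real.pi := ⟨hx.1, hx.2.le⟩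
  obtain ⟨hne, hlim⟩ := F.tendsto_psi (x := x) ⟨hx.1.le, hx.2⟩
  have hinv : Tendsto (fun μ : ℂ => μ⁻¹) upper (𝓝 0) :=
    tendsto_zero_iff_norm_tendsto_zero.2
      (tendsto_norm_upper.inv_tendsto_atTop.congr fun μ => (norm_inv μ).symm)
  have hd := ((F.tendsto_logDeriv_S hxo).sub hlim).inv₀ (by
    intro h
    have h2 : Complex.I = 0 := by linear_combination (-1 / 2 : ℂ) * h
    exact Complex.I_ne_zero h2)
  have := hinv.mul hd
  rw [zero_mul] at this
  refine this.congr' ?_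
  filter_upwards [hne, F.eventually_S_ne_zero hxo, F.eventually_S_ne_zero (x := Real.pi)
    ⟨Real.pi_pos, le_rfl⟩, eventually_upper_ne_zero] with μ e1 e2 e3 e4
  have hw := F.wronskian_eq_one μ (x := x) ⟨hx.1.le, hx.2.le⟩
  set P := S μ Real.pi * C μ x + -C μ Real.pi * S μ x with hP
  set P1 := S μ Real.pi * C1 μ x + -C μ Real.pi * S1 μ x with hP1
  have hW : S1 μ x * P - P1 * S μ x = S μ Real.pi := by
    rw [hP, hP1]; linear_combination (S μ Real.pi) * hw
  have : S1 μ x / (μ * S μ x) - P1 / (μ * P) = S μ Real.pi / (μ * (S μ x * P)) := by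
    rw [← hW]; field_simp
  rw [this]
  field_simp

end Fundamental

/-! ### Entire functions: quotients, a Liouville theorem, and residues -/

/-- A bound from below for a zero-free holomorphic function: the Borel–Carathéodory inequality,
applied to a holomorphic logarithm. -/
lemma exp_le_norm_of_ne_zero {A r : ℝ} (hA : 0 < A) (hr : 0 < r) {G : ℂ → ℂ}
    (hG : Differentiable ℂ G) (hb : ∀ z ∈ Metric.ball (0 : ℂ) r, ‖G z‖ ≤ Real.exp A)
    (h0 : Real.exp (-A) ≤ ‖G 0‖) (hne : ∀ z ∈ Metric.ball (0 : ℂ) r, G z ≠ 0)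
    {z : ℂ} (hz : ‖z‖ ≤ r / 2) : Real.exp (-(5 * A)) ≤ ‖G z‖ := by
  have hG' : Differentiable ℂ (deriv G) :=
    fun z => ((hG.analyticAt z).deriv).differentiableAt
  obtain ⟨L, hL⟩ := DifferentiableOn.isExactOn_ball (f := fun z => deriv G z / G z) (c := 0)
    (r := r)
    (fun z hz => ((hG' z).div (hG z) (hne z hz)).differentiableWithinAt)
  have h0m : (0 : ℂ) ∈ Metric.ball (0 : ℂ) r := Metric.mem_ball_self hr
  have hconst : ∀ w ∈ Metric.ball (0 : ℂ) r,
      Complex.exp (-L w) * G w = Complex.exp (-L 0) * G 0 := by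
    intro w hw
    refine (convex_ball (0 : ℂ) r).is_const_of_fderivWithin_eq_zero (𝕜 := ℂ)
      (f := fun w => Complex.exp (-L w) * G w) ?_ ?_ hw h0m
    · intro w hw
      exact (((hL w hw).neg.cexp.mul (hG w).hasDerivAt).differentiableAt).differentiableWithinAt
    · intro w hw
      rw [fderivWithin_of_isOpen Metric.isOpen_ball hw]
      have := (hL w hw).neg.cexp.mul (hG w).hasDerivAt
      have hz : Complex.exp (-L w) * -(deriv G w / G w) * G w +
          Complex.exp (-L w) * deriv G w = 0 := by
        have := hne w hw
        field_simp; ring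
      have h0 : HasDerivAt (fun w => Complex.exp (-L w) * G w) 0 w := by
        convert! this using 1
        exact hz.symm
      simpa using h0.hasFDerivAt.fderiv
  have hGL : ∀ w ∈ Metric.ball (0 : ℂ) r, G w = G 0 * Complex.exp (L w - L 0) := fun w hw => by
    have h1 := hconst w hw
    have h2 : G w = Complex.exp (L w) * (Complex.exp (-L w) * G w) := by
      rw [← mul_assoc, ← Complex.exp_add]; simp
    rw [h2, h1, ← mul_assoc, ← Complex.exp_add, mul_comm]
    ring_nf
  have hnorm : ∀ w ∈ Metric.ball (0 : ℂ) r,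
      ‖G w‖ = ‖G 0‖ * Real.exp (L w - L 0).re := fun w hw => by
    rw [hGL w hw, norm_mul, Complex.norm_exp]
  have hzr : z ∈ Metric.ball (0 : ℂ) r := by rw [mem_ball_zero_iff]; linarith
  have hBC := Complex.borelCaratheodory_zero (f := fun w => L w - L 0) (M := 2 * A) (R := r)
    (z := z)
    (by positivity)
    (fun w hw => ((hL w hw).differentiableAt.sub_const _).differentiableWithinAt)
    (fun w hw => by
      have h1 := hb w hw
      rw [hnorm w hw] at h1
      have h2 : Real.exp (-A) * Real.exp (L w - L 0).re ≤ Real.exp A :=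
        (mul_le_mul_of_nonneg_right h0 (Real.exp_pos _).le).trans h1
      rw [← Real.exp_add, Real.exp_le_exp] at h2
      simp only [Set.mem_ofPred_eq]
      linarith) hr hzr (by simp)
  have hle : 2 * (2 * A) * ‖z‖ / (r - ‖z‖) ≤ 4 * A := by
    rw [div_le_iff₀ (by linarith)]
    nlinarith
  have hre : -(4 * A) ≤ (L z - L 0).re := by
    have := (Complex.abs_re_le_norm (L z - L 0)).trans (hBC.trans hle)
    linarith [neg_abs_le (L z - L 0).re]
  rw [hnorm z hzr]
  calc Real.exp (-(5 * A)) = Real.exp (-A) * Real.exp (-(4 * A)) := by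
        rw [← Real.exp_add]; ring_nf
    _ ≤ _ := by gcongr

lemma norm_le_of_norm_le_sphere {f : ℂ → ℂ} (hf : Differentiable ℂ f) {R M : ℝ} (hR : 0 < R)
    (h : ∀ z, ‖z‖ = R → ‖f z‖ ≤ M) {z : ℂ} (hz : ‖z‖ ≤ R) : ‖f z‖ ≤ M := by
  refine Complex.norm_le_of_forall_mem_frontier_norm_le (U := Metric.ball 0 R)
    Metric.isBounded_ball hf.diffContOnCl (fun w hw => ?_) ?_
  · rw [frontier_ball _ hR.ne'] at hw
    exact h w (by simpa using hw)
  · rw [closure_ball _ hR.ne']; simpa using hz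

lemma norm_quotient_le_of_ne_zero {A R : ℝ} (hA : 0 < A) (hR : 0 < R) {h G : ℂ → ℂ}
    (hh : Differentiable ℂ h) (hG : Differentiable ℂ G)
    (hb : ∀ z, ‖z‖ = R → ‖G z‖ ≤ Real.exp A) (hhb : ∀ z, ‖z‖ = R → ‖h z * G z‖ ≤ Real.exp A)
    (h0 : Real.exp (-A) ≤ ‖G 0‖) (hne : ∀ a ∈ Metric.ball (0 : ℂ) (R / 2), G a ≠ 0) {z : ℂ}
    (hz : ‖z‖ ≤ R / 4) : ‖h z‖ ≤ Real.exp (6 * A) := by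
  have h1 := exp_le_norm_of_ne_zero hA (half_pos hR) hG (fun w hw =>
    norm_le_of_norm_le_sphere hG hR hb (by linarith [mem_ball_zero_iff.1 hw])) h0 hne
    (z := z) (by linarith)
  have h2 := norm_le_of_norm_le_sphere (hh.mul hG) hR hhb (z := z) (by linarith)
  simp only [Pi.mul_apply, norm_mul] at h2
  have h3 : ‖h z‖ * Real.exp (-(5 * A)) ≤ Real.exp A :=
    (mul_le_mul_of_nonneg_left h1 (norm_nonneg _)).trans h2
  calc ‖h z‖ = ‖h z‖ * Real.exp (-(5 * A)) * Real.exp (5 * A) := by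
        rw [mul_assoc, ← Real.exp_add]; simp
    _ ≤ Real.exp A * Real.exp (5 * A) := by gcongr
    _ = Real.exp (6 * A) := by rw [← Real.exp_add]; ring_nf

/-- A quotient `h = F / G` of entire functions is bounded in terms of bounds for `F` and `G` on a
circle and a bound from below for `G` at the centre. The zeros of `G` in the disc of radius `R / 2`
are divided out one by one by Blaschke factors; each of them at least doubles `|G(0)|`, so that this
takes at most `N` steps. -/
lemma norm_quotient_le {A R : ℝ} (hA : 0 < A) (hR : 0 < R) {h : ℂ → ℂ} (hh : Differentiable ℂ h)
    (N : ℕ) : ∀ G : ℂ → ℂ, Differentiable ℂ G → (∀ z, ‖z‖ = R → ‖G z‖ ≤ Real.exp A) →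
    (∀ z, ‖z‖ = R → ‖h z * G z‖ ≤ Real.exp A) → Real.exp (-A) ≤ ‖G 0‖ →
    Real.exp A ≤ 2 ^ N * ‖G 0‖ → ∀ z, ‖z‖ ≤ R / 4 → ‖h z‖ ≤ Real.exp (6 * A) := by
  induction N with
  | zero =>
    intro G hG hb hhb h0 hN z hz
    by_cases hex : ∃ a ∈ Metric.ball (0 : ℂ) (R / 2), G a = 0
    · -- By the maximum principle `G` has constant modulus on the disc, hence is constant.
      obtain ⟨a, ha, hGa⟩ := hex
      exfalso
      have hmax : IsMaxOn (norm ∘ G) (Metric.ball (0 : ℂ) R) 0 := fun w hw => by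
        have := norm_le_of_norm_le_sphere hG hR hb (z := w)
          (by simpa using (mem_ball_zero_iff.1 hw).le)
        simp only [pow_zero, one_mul] at hN
        exact this.trans hN
      have := Complex.eqOn_of_isPreconnected_of_isMaxOn_norm (convex_ball (0 : ℂ) R).isPreconnected
        Metric.isOpen_ball hG.differentiableOn (Metric.mem_ball_self hR) hmax
        (Metric.ball_subset_ball (by linarith) ha)
      rw [hGa] at this
      simp only [Function.const_apply] at this
      rw [← this, norm_zero] at h0
      exact absurd h0 (not_le.2 (Real.exp_pos _))
    · push Not at hex
      exact norm_quotient_le_of_ne_zero hA hR hh hG hb hhb h0 hex hz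
  | succ N ih =>
    intro G hG hb hhb h0 hN z hz
    by_cases hex : ∃ a ∈ Metric.ball (0 : ℂ) (R / 2), G a = 0
    · obtain ⟨a, ha, hGa⟩ := hex
      have haR : ‖a‖ < R / 2 := mem_ball_zero_iff.1 ha
      have ha0 : a ≠ 0 := fun h => by
        rw [h] at hGa
        rw [hGa, norm_zero] at h0
        exact absurd h0 (not_le.2 (Real.exp_pos _))
      set G₁ : ℂ → ℂ := fun z => dslope G a z * ((R ^ 2 - (starRingEnd ℂ) a * z) / R) with hG₁
      have hd : Differentiable ℂ (dslope G a) := by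
        rw [← differentiableOn_univ] at hG ⊢
        exact (Complex.differentiableOn_dslope univ_mem).2 hG
      have hG₁d : Differentiable ℂ G₁ := hd.mul (by fun_prop)
      have hslope : ∀ z, (z - a) * dslope G a z = G z := fun z => by
        have := sub_smul_dslope G a z
        rwa [hGa, sub_zero, smul_eq_mul] at this
      have hsph : ∀ z : ℂ, ‖z‖ = R → ‖G₁ z‖ = ‖G z‖ := fun z hz => by
        have e : ‖(R ^ 2 - (starRingEnd ℂ) a * z) / (R : ℂ)‖ = ‖z - a‖ := by
          have hzz : (R : ℂ) ^ 2 = (starRingEnd ℂ) z * z := by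
            rw [← Complex.normSq_eq_conj_mul_self, Complex.normSq_eq_norm_sq, hz]; simp
          rw [hzz, ← sub_mul, ← map_sub, norm_div, norm_mul, RCLike.norm_conj, hz,
            Complex.norm_real, Real.norm_of_nonneg hR.le]
          field_simp
        rw [hG₁, ← hslope z]
        simp only [norm_mul, e]
        ring
      have hzero : 2 * ‖G 0‖ ≤ ‖G₁ 0‖ := by
        have e1 : ‖G 0‖ = ‖a‖ * ‖dslope G a 0‖ := by rw [← hslope 0]; simp
        have e2 : ‖G₁ 0‖ = ‖dslope G a 0‖ * R := by
          simp only [hG₁, mul_zero, sub_zero, norm_mul, norm_div, norm_pow, Complex.norm_real,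
            Real.norm_of_nonneg hR.le]
          field_simp
        rw [e1, e2]
        nlinarith [norm_nonneg (dslope G a 0)]
      refine ih G₁ hG₁d (fun z hz => (hsph z hz).trans_le (hb z hz)) (fun z hz => ?_) ?_ ?_ z hz
      · have := hhb z hz
        rwa [norm_mul, hsph z hz, ← norm_mul]
      · linarith [norm_nonneg (G 0)]
      · calc Real.exp A ≤ 2 ^ (N + 1) * ‖G 0‖ := hN
          _ = 2 ^ N * (2 * ‖G 0‖) := by ring
          _ ≤ _ := by gcongr
    · push Not at hex
      exact norm_quotient_le_of_ne_zero hA hR hh hG hb hhb h0 hex hz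

/-- Growth condition on horizontal strips that suffices for the Phragmén–Lindelöf principle. -/
def StripGrowth (f : ℂ → ℂ) : Prop :=
  ∀ T : ℝ, ∃ B X : ℝ, ∀ z : ℂ, |z.im| ≤ T → X ≤ |z.re| →
    ‖f z‖ ≤ Real.exp (B * (1 + |z.re|) ^ 2)

lemma QuadGrowth.stripGrowth {f : ℂ → ℂ} (hf : QuadGrowth f) : StripGrowth f := fun T => by
  obtain ⟨A, hA, h⟩ := hf
  refine ⟨A * (1 + |T|) ^ 2, 0, fun z hz _ => (h z).trans ?_⟩
  rw [mul_assoc, ← mul_pow]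
  gcongr
  have := Complex.norm_le_abs_re_add_abs_im z
  nlinarith [abs_nonneg z.re, abs_nonneg T, hz.trans (le_abs_self T),
    mul_nonneg (abs_nonneg T) (abs_nonneg z.re)]

lemma exp_quad_isBigO {B c : ℝ} (hc : 0 < c) :
    ∃ B' : ℝ, ∀ r : ℝ, 0 ≤ r → Real.exp (B * (1 + r) ^ 2) ≤ Real.exp (B' * Real.exp (c * r)) := by
  refine ⟨|B| * (2 + 4 / c ^ 2), fun r hr => Real.exp_le_exp.2 ?_⟩
  have h1 := Real.quadratic_le_exp_of_nonneg (mul_nonneg hc.le hr)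
  have h2 : (1 + r) ^ 2 ≤ (2 + 4 / c ^ 2) * Real.exp (c * r) := by
    have h3 : r ^ 2 = (c * r) ^ 2 / c ^ 2 := by field_simp
    have h4 : (c * r) ^ 2 ≤ 2 * Real.exp (c * r) := by nlinarith [mul_nonneg hc.le hr]
    have h5 : r ^ 2 ≤ 2 * Real.exp (c * r) / c ^ 2 := by rw [h3]; gcongr
    have h6 : 1 ≤ Real.exp (c * r) := Real.one_le_exp (mul_nonneg hc.le hr)
    have h7 : 4 / c ^ 2 * Real.exp (c * r) = 2 * (2 * Real.exp (c * r) / c ^ 2) := by ring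
    nlinarith [sq_nonneg (r - 1)]
  calc B * (1 + r) ^ 2 ≤ |B| * (1 + r) ^ 2 := by gcongr; exact le_abs_self B
    _ ≤ |B| * ((2 + 4 / c ^ 2) * Real.exp (c * r)) := by gcongr
    _ = _ := by ring

lemma eventually_upper_iff {p : ℂ → Prop} :
    (∀ᶠ μ in upper, p μ) ↔ ∃ T : ℝ, ∀ μ : ℂ, T ≤ μ.im → p μ := by
  rw [(atTop_basis.comap Complex.im).eventually_iff]
  simp

/-- An entire function of moderate growth with limits as `Im μ → ±∞` is constant. -/
lemma eq_const_of_tendsto {f : ℂ → ℂ} (hf : Differentiable ℂ f) (hg : StripGrowth f) {a b : ℂ}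
    (ha : Tendsto f upper (𝓝 a)) (hb : Tendsto (fun μ => f (-μ)) upper (𝓝 b)) :
    a = b ∧ ∀ μ, f μ = a := by
  obtain ⟨T₁, h₁⟩ := eventually_upper_iff.1 (ha.norm.eventually_le_const (lt_add_one ‖a‖))
  obtain ⟨T₂, h₂⟩ := eventually_upper_iff.1 (hb.norm.eventually_le_const (lt_add_one ‖b‖))
  set T := max (max T₁ T₂) 1 with hT
  have hT0 : 0 < T := lt_of_lt_of_le one_pos (le_max_right _ _)
  set M := ‖a‖ + ‖b‖ + 1 with hM
  have up : ∀ z : ℂ, T ≤ z.im → ‖f z‖ ≤ M := fun z hz =>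
    (h₁ z (((le_max_left _ _).trans (le_max_left _ _)).trans hz)).trans
      (by rw [hM]; linarith [norm_nonneg b])
  have lo : ∀ z : ℂ, z.im ≤ -T → ‖f z‖ ≤ M := fun z hz => by
    have := h₂ (-z) (((le_max_right T₁ _).trans (le_max_left _ _)).trans
      (by rw [Complex.neg_im]; linarith))
    rw [neg_neg] at this
    rw [hM]; linarith [norm_nonneg a]
  have hbd : ∀ z, ‖f z‖ ≤ M := fun z => by
    rcases le_total T z.im with h | h
    · exact up z h
    rcases le_total z.im (-T) with h' | h'
    · exact lo z h'
    refine PhragmenLindelof.horizontal_strip (a := -T) (b := T) hf.diffContOnCl ?_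
      (fun w hw => lo w hw.le) (fun w hw => up w hw.ge) h' h
    have hc : 0 < Real.pi / (4 * T) := by positivity
    obtain ⟨B, X, hB⟩ := hg T
    obtain ⟨B', hB'⟩ := exp_quad_isBigO (B := B) hc
    refine ⟨Real.pi / (4 * T), ?_, B', Asymptotics.IsBigO.of_bound 1 ?_⟩
    · rw [sub_neg_eq_add, ← two_mul]
      exact div_lt_div_of_pos_left Real.pi_pos (by positivity) (by linarith)
    · rw [eventually_inf_principal]
      filter_upwards [preimage_mem_comap (Ici_mem_atTop X)] with w hw hwm
      have h1 := hB w (abs_le.2 ⟨hwm.1.le, hwm.2.le⟩) hw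
      rw [one_mul, Real.norm_of_nonneg (Real.exp_pos _).le]
      exact h1.trans (hB' _ (abs_nonneg _))
  have hconst : ∀ μ, f μ = f 0 := fun μ => hf.apply_eq_apply_of_bounded
    (isBounded_iff_forall_norm_le.2 ⟨M, by rintro _ ⟨z, rfl⟩; exact hbd z⟩) μ 0
  have e1 : a = f 0 := tendsto_nhds_unique ha (tendsto_const_nhds.congr fun μ => (hconst μ).symm)
  have e2 : b = f 0 := tendsto_nhds_unique hb (tendsto_const_nhds.congr fun μ => (hconst (-μ)).symm)
  exact ⟨e1.trans e2.symm, fun μ => by rw [hconst, e1]⟩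

/-- A function which has removable singularities everywhere extends to an entire function. -/
lemma exists_entire_of_removable {Q : ℂ → ℂ}
    (h : ∀ z, ∃ e : ℂ → ℂ, AnalyticAt ℂ e z ∧ ∀ᶠ w in 𝓝[≠] z, Q w = e w) :
    ∃ E : ℂ → ℂ, Differentiable ℂ E ∧ ∀ z, ∀ᶠ w in 𝓝[≠] z, E w = Q w := by
  have hlim : ∀ z e, AnalyticAt ℂ e z → (∀ᶠ w in 𝓝[≠] z, Q w = e w) →
      limUnder (𝓝[≠] z) Q = e z := fun z e he hQ =>
    ((he.continuousAt.tendsto.mono_left nhdsWithin_le_nhds).congr'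
      (hQ.mono fun w hw => hw.symm)).limUnder_eq
  have hloc : ∀ z e, AnalyticAt ℂ e z → (∀ᶠ w in 𝓝[≠] z, Q w = e w) →
      (∀ᶠ w in 𝓝[≠] z, limUnder (𝓝[≠] w) Q = e w) := fun z e he hQ => by
    filter_upwards [eventually_eventually_nhdsWithin.2 hQ,
      nhdsWithin_le_nhds he.eventually_analyticAt, self_mem_nhdsWithin] with w h1 h2 h3
    refine hlim w e h2 ?_
    rw [isOpen_compl_singleton.nhdsWithin_eq h3] at h1
    exact nhdsWithin_le_nhds h1
  refine ⟨fun z => limUnder (𝓝[≠] z) Q, fun z => ?_, fun z => ?_⟩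
  · obtain ⟨e, he, hQ⟩ := h z
    refine he.differentiableAt.congr_of_eventuallyEq ?_
    have h1 := hloc z e he hQ
    have h2 := hlim z e he hQ
    rw [eventually_nhdsWithin_iff] at h1
    filter_upwards [h1] with w hw
    by_cases hwz : w = z
    · rw [hwz]; exact h2
    · exact hw hwz
  · obtain ⟨e, he, hQ⟩ := h z
    filter_upwards [hloc z e he hQ, hQ] with w h1 h2
    rw [h1, h2]

/-- If finitely many residues `Res (ζ - z)^ν f`, `ν < m`, of two functions with at most a pole of
order `m` agree, then the difference has a removable singularity. Here the functions are given as
`(ζ - z)^{-m} u` and `(ζ - z)^{-m} v` with holomorphic `u`, `v`. -/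
lemma exists_analyticAt_of_residues {z : ℂ} {m : ℕ} {f g u v : ℂ → ℂ} (hu : AnalyticAt ℂ u z)
    (hv : AnalyticAt ℂ v z) (hf : ∀ᶠ w in 𝓝[≠] z, f w = u w / (w - z) ^ m)
    (hg : ∀ᶠ w in 𝓝[≠] z, g w = v w / (w - z) ^ m)
    (hres : ∀ ν < m, ∃ c, HasResidueAt (fun w => (w - z) ^ ν * f w) z c ∧
      HasResidueAt (fun w => (w - z) ^ ν * g w) z c) :
    ∃ e : ℂ → ℂ, AnalyticAt ℂ e z ∧ ∀ᶠ w in 𝓝[≠] z, f w - g w = e w := by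
  have hord : (m : ℕ∞) ≤ analyticOrderAt (fun w => u w - v w) z := by
    by_contra hlt
    rw [not_le] at hlt
    -- Otherwise `u - v` has a zero of order `k < m`, and the residue with `ν = m - 1 - k` sees the
    -- leading coefficient.
    obtain ⟨k, hk⟩ := ENat.ne_top_iff_exists.1 hlt.ne_top
    rw [← hk, Nat.cast_lt] at hlt
    obtain ⟨p, hp, hp0, hpe⟩ := ((hu.sub hv).analyticOrderAt_eq_natCast).1 hk.symm
    obtain ⟨c, hc1, hc2⟩ := hres (m - 1 - k) (by omega)
    rw [eventually_nhdsWithin_iff] at hf hg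
    obtain ⟨ε, hε, hball⟩ := Metric.eventually_nhds_iff.1
      (hf.and (hg.and (hpe.and (hp.eventually_analyticAt.and
        (hu.eventually_analyticAt.and hv.eventually_analyticAt)))))
    have hr : ∀ᶠ r : ℝ in 𝓝[>] 0, r ∈ Set.Ioo 0 ε := Ioo_mem_nhdsGT hε
    obtain ⟨r, h1, h2, hr0, hrε⟩ := (hc1.and (hc2.and hr)).exists
    have hmem : ∀ {w}, w ∈ Metric.closedBall z r → dist w z < ε := fun hw =>
      (Metric.mem_closedBall.1 hw).trans_lt hrε
    have hsph : ∀ {w}, w ∈ Metric.sphere z r → w ∈ Metric.closedBall z r ∧ w ≠ z := fun hw =>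
      ⟨Metric.sphere_subset_closedBall hw, fun h => by
        rw [h, Metric.mem_sphere, dist_self] at hw; exact hr0.ne hw⟩
    have hci : ∀ {φ φ₀ : ℂ → ℂ}, (∀ w ∈ Metric.sphere z r, φ w = φ₀ w / (w - z) ^ m) →
        (∀ w ∈ Metric.sphere z r, AnalyticAt ℂ φ₀ w) →
        CircleIntegrable (fun w => (w - z) ^ (m - 1 - k) * φ w) z r := fun hφ hφ₀ => by
      refine ContinuousOn.circleIntegrable hr0.le ?_
      refine ContinuousOn.mul (by fun_prop) (ContinuousOn.congr (f := fun w => _ / (w - z) ^ m)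
        (ContinuousOn.div (fun w hw => (hφ₀ w hw).continuousAt.continuousWithinAt) (by fun_prop)
          fun w hw => pow_ne_zero _ (sub_ne_zero.2 (hsph hw).2)) hφ)
    have i1 := hci (φ := f) (φ₀ := u) (fun w hw => (hball (hmem (hsph hw).1)).1 (hsph hw).2)
      (fun w hw => (hball (hmem (hsph hw).1)).2.2.2.2.1)
    have i2 := hci (φ := g) (φ₀ := v) (fun w hw => (hball (hmem (hsph hw).1)).2.1 (hsph hw).2)
      (fun w hw => (hball (hmem (hsph hw).1)).2.2.2.2.2)
    have hdiff :
        (∮ w in C(z, r), ((w - z) ^ (m - 1 - k) * f w - (w - z) ^ (m - 1 - k) * g w)) = 0 := by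
      rw [circleIntegral.integral_sub i1 i2]
      have := h1.trans h2.symm
      exact sub_eq_zero.2 (mul_left_cancel₀ (inv_ne_zero Complex.two_pi_I_ne_zero) this)
    have hpd : DiffContOnCl ℂ p (Metric.ball z r) := by
      refine DifferentiableOn.diffContOnCl fun w hw => ?_
      rw [closure_ball _ hr0.ne'] at hw
      exact (hball (hmem hw)).2.2.2.1.differentiableAt.differentiableWithinAt
    have hcauchy := hpd.circleIntegral_sub_inv_smul (Metric.mem_ball_self hr0)
    have heq : (∮ w in C(z, r), ((w - z) ^ (m - 1 - k) * f w - (w - z) ^ (m - 1 - k) * g w)) =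
        ∮ w in C(z, r), (w - z)⁻¹ • p w := by
      refine circleIntegral.integral_congr hr0.le fun w hw => ?_
      obtain ⟨b1, b2, b3, -⟩ := hball (hmem (hsph hw).1)
      have hne : w - z ≠ 0 := sub_ne_zero.2 (hsph hw).2
      simp only [smul_eq_mul] at b3 ⊢
      rw [b1 (hsph hw).2, b2 (hsph hw).2, ← mul_sub, ← sub_div]
      simp only [Pi.sub_apply] at b3
      rw [b3, inv_mul_eq_div, ← mul_div_assoc, div_eq_div_iff (pow_ne_zero _ hne) hne]
      have : (w - z) ^ m = (w - z) ^ (m - 1 - k) * (w - z) ^ k * (w - z) := by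
        rw [← pow_add, ← pow_succ]; congr 1; omega
      rw [this]; ring
    rw [← heq, hdiff, smul_eq_mul] at hcauchy
    exact (mul_ne_zero Complex.two_pi_I_ne_zero hp0) hcauchy.symm
  obtain ⟨e, he, hee⟩ := (natCast_le_analyticOrderAt (hu.sub hv)).1 hord
  refine ⟨e, he, ?_⟩
  filter_upwards [hf, hg, nhdsWithin_le_nhds hee, self_mem_nhdsWithin] with w h1 h2 h3 h4
  have hne : w - z ≠ 0 := sub_ne_zero.2 h4
  simp only [Pi.sub_apply, smul_eq_mul] at h3
  rw [h1, h2, ← sub_div, h3, mul_div_cancel_left₀ _ (pow_ne_zero _ hne)]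

/-- Two Weyl functions `-C/D` with the same poles and the same principal parts differ by an entire
function. -/
lemma exists_entire_sub_weyl {D D' C C' W W' : ℂ → ℂ} (hD : Differentiable ℂ D)
    (hD' : Differentiable ℂ D') (hC : Differentiable ℂ C) (hC' : Differentiable ℂ C')
    (hord : ∀ z, analyticOrderAt D z = analyticOrderAt D' z) (htop : ∀ z, analyticOrderAt D z ≠ ⊤)
    (hW : ∀ z, D z ≠ 0 → W z = -C z / D z) (hW' : ∀ z, D' z ≠ 0 → W' z = -C' z / D' z)
    (hres : ∀ z, ∀ ν : ℕ, (ν : ℕ∞) < analyticOrderAt D z → ∃ c,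
      HasResidueAt (fun w => (w - z) ^ ν * W w) z c ∧
      HasResidueAt (fun w => (w - z) ^ ν * W' w) z c) :
    ∃ E : ℂ → ℂ, Differentiable ℂ E ∧
      ∀ z, E z * (D z * D' z) = C' z * D z - C z * D' z := by
  have hloc : ∀ {D C W : ℂ → ℂ}, Differentiable ℂ D → Differentiable ℂ C →
      (∀ z, D z ≠ 0 → W z = -C z / D z) → ∀ z (m : ℕ), analyticOrderAt D z = m →
      ∃ u, AnalyticAt ℂ u z ∧ (∀ᶠ w in 𝓝[≠] z, W w = u w / (w - z) ^ m) ∧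
        ∀ᶠ w in 𝓝[≠] z, D w ≠ 0 := by
    intro D C W hD hC hW z m hm
    obtain ⟨a, ha, ha0, hae⟩ := ((hD.analyticAt z).analyticOrderAt_eq_natCast).1 hm
    have hDne : ∀ᶠ w in 𝓝[≠] z, D w ≠ 0 := by
      filter_upwards [nhdsWithin_le_nhds hae,
        nhdsWithin_le_nhds (ha.continuousAt.eventually_ne ha0), self_mem_nhdsWithin] with w h1 h2 h3
      rw [h1, smul_eq_mul]
      exact mul_ne_zero (pow_ne_zero _ (sub_ne_zero.2 h3)) h2
    refine ⟨fun w => -C w / a w, (hC.analyticAt z).neg.div ha ha0, ?_, hDne⟩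
    filter_upwards [nhdsWithin_le_nhds hae, hDne] with w h1 h3
    rw [hW w h3, h1, smul_eq_mul, div_div, mul_comm]
  have key : ∀ z, ∃ e : ℂ → ℂ, AnalyticAt ℂ e z ∧ ∀ᶠ w in 𝓝[≠] z, W w - W' w = e w := by
    intro z
    obtain ⟨m, hm⟩ := ENat.ne_top_iff_exists.1 (htop z)
    obtain ⟨u, hu, hue, -⟩ := hloc hD hC hW z m hm.symm
    obtain ⟨v, hv, hve, -⟩ := hloc hD' hC' hW' z m ((hord z).symm.trans hm.symm)
    refine exists_analyticAt_of_residues hu hv hue hve fun ν hν => hres z ν ?_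
    rw [← hm]; exact_mod_cast hν
  obtain ⟨E, hE, hEQ⟩ := exists_entire_of_removable (Q := fun w => W w - W' w) key
  refine ⟨E, hE, fun z => ?_⟩
  obtain ⟨m, hm⟩ := ENat.ne_top_iff_exists.1 (htop z)
  obtain ⟨u, hu, hue, hne⟩ := hloc hD hC hW z m hm.symm
  obtain ⟨v, hv, hve, hne'⟩ := hloc hD' hC' hW' z m ((hord z).symm.trans hm.symm)
  have hev : ∀ᶠ w in 𝓝[≠] z, E w * (D w * D' w) = C' w * D w - C w * D' w := by
    filter_upwards [hEQ z, hne, hne'] with w h1 h2 h3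
    rw [h1, hW w h2, hW' w h3]
    field_simp
    ring
  have c1 : Tendsto (fun w => E w * (D w * D' w)) (𝓝[≠] z) (𝓝 (E z * (D z * D' z))) :=
    ((hE.mul (hD.mul hD')).continuous.tendsto z).mono_left nhdsWithin_le_nhds
  have c2 : Tendsto (fun w => C' w * D w - C w * D' w) (𝓝[≠] z)
      (𝓝 (C' z * D z - C z * D' z)) :=
    (((hC'.mul hD).sub (hC.mul hD')).continuous.tendsto z).mono_left nhdsWithin_le_nhds
  exact tendsto_nhds_unique (c1.congr' hev) c2

/-- An entire function of moderate growth which is `o(μ)` as `Im μ → ±∞` is constant. -/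
lemma eq_apply_zero_of_sublinear {E : ℂ → ℂ} (hE : Differentiable ℂ E) (hg : StripGrowth E)
    (h₁ : Tendsto (fun μ => E μ / μ) upper (𝓝 0))
    (h₂ : Tendsto (fun μ => E (-μ) / μ) upper (𝓝 0)) (μ : ℂ) : E μ = E 0 := by
  have hd : Differentiable ℂ (dslope E 0) := by
    rw [← differentiableOn_univ] at hE ⊢
    exact (Complex.differentiableOn_dslope univ_mem).2 hE
  have hval : ∀ w : ℂ, w ≠ 0 → dslope E 0 w = E w / w - E 0 / w := fun w hw => by
    rw [dslope_of_ne _ hw, slope_def_field, sub_zero, sub_div]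
  have hinv : Tendsto (fun μ : ℂ => E 0 / μ) upper (𝓝 0) := by
    refine tendsto_zero_iff_norm_tendsto_zero.2 ?_
    have := tendsto_norm_upper.inv_tendsto_atTop.const_mul ‖E 0‖
    rw [mul_zero] at this
    exact this.congr fun μ => by simp [div_eq_mul_inv]
  have l1 : Tendsto (dslope E 0) upper (𝓝 0) := by
    have := h₁.sub hinv
    rw [sub_zero] at this
    refine this.congr' ?_
    filter_upwards [eventually_upper_ne_zero] with w hw using (hval w hw).symm
  have l2 : Tendsto (fun μ => dslope E 0 (-μ)) upper (𝓝 0) := by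
    have := (h₂.sub hinv).neg
    rw [sub_zero, neg_zero] at this
    refine this.congr' ?_
    filter_upwards [eventually_upper_ne_zero] with w hw
    rw [hval _ (neg_ne_zero.2 hw), div_neg, div_neg]; ring
  have hs : StripGrowth (dslope E 0) := fun T => by
    obtain ⟨B, X, hB⟩ := hg T
    refine ⟨|B| + (1 + ‖E 0‖), max X 1, fun z hz hX => ?_⟩
    have hz1 : 1 ≤ ‖z‖ := ((le_max_right X 1).trans hX).trans (Complex.abs_re_le_norm z)
    have hz0 : z ≠ 0 := norm_pos_iff.1 (one_pos.trans_le hz1)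
    have hq : 1 ≤ (1 + |z.re|) ^ 2 := by nlinarith [abs_nonneg z.re]
    have b1 : ‖E z‖ ≤ Real.exp (|B| * (1 + |z.re|) ^ 2) :=
      (hB z hz ((le_max_left X 1).trans hX)).trans (by gcongr; exact le_abs_self B)
    have b2 : 1 ≤ Real.exp (|B| * (1 + |z.re|) ^ 2) := Real.one_le_exp (by positivity)
    have b3 : 1 + ‖E 0‖ ≤ Real.exp ((1 + ‖E 0‖) * (1 + |z.re|) ^ 2) := by
      have : 1 + ‖E 0‖ ≤ (1 + ‖E 0‖) * (1 + |z.re|) ^ 2 :=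
        le_mul_of_one_le_right (by positivity) hq
      linarith [Real.add_one_le_exp ((1 + ‖E 0‖) * (1 + |z.re|) ^ 2)]
    have b4 : ‖dslope E 0 z‖ ≤ ‖E z‖ + ‖E 0‖ := by
      rw [hval z hz0, ← sub_div, norm_div]
      exact (div_le_self (norm_nonneg _) hz1).trans (norm_sub_le _ _)
    rw [add_mul, Real.exp_add]
    calc ‖dslope E 0 z‖ ≤ ‖E z‖ + ‖E 0‖ := b4
      _ ≤ Real.exp (|B| * (1 + |z.re|) ^ 2) * (1 + ‖E 0‖) := by
          nlinarith [norm_nonneg (E 0)]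
      _ ≤ _ := by gcongr
  have hz := (eq_const_of_tendsto hd hs l1 l2).2 μ
  have := sub_smul_dslope E 0 μ
  rw [hz, smul_zero] at this
  exact (sub_eq_zero.1 this.symm)

namespace Fundamental

variable {s q s' q' : ℝ → ℂ} {S S1 C C1 S' S1' C' C1' : ℂ → ℝ → ℂ}

/-- Above some horizontal line, `S(π, μ)` decays at most like `1 / μ`. -/
lemma exists_lower_bound (F : Fundamental s q S S1 C C1) :
    ∃ T c : ℝ, 0 < c ∧ ∀ μ : ℂ, T ≤ μ.im → c ≤ ‖μ‖ * ‖S μ Real.pi‖ := by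
  have hlim := (F.tendsto_S (x := Real.pi) ⟨Real.pi_pos, le_rfl⟩).norm
  set L := ‖Complex.exp (∫ t in (0 : ℝ)..Real.pi, Complex.I * q t)‖ with hL
  have hL0 : 0 < L := norm_pos_iff.2 (Complex.exp_ne_zero _)
  obtain ⟨T, hT⟩ := eventually_upper_iff.1 (hlim.eventually_const_le (half_lt_self hL0))
  refine ⟨max T 0, L / 4, by positivity, fun μ hμ => ?_⟩
  have h1 := hT μ ((le_max_left _ _).trans hμ)
  have h2 : ‖Complex.exp (Complex.I * μ * Real.pi)‖ ≤ 1 := by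
    rw [Complex.norm_exp, Real.exp_le_one_iff]
    have : (Complex.I * μ * Real.pi).re = -(μ.im * Real.pi) := by simp
    rw [this]
    exact neg_nonpos.2 (mul_nonneg ((le_max_right _ _).trans hμ) Real.pi_pos.le)
  simp only [norm_mul, norm_neg, Complex.norm_ofNat, Complex.norm_I, mul_one] at h1
  have h3 : 0 ≤ ‖μ‖ * ‖S μ Real.pi‖ := by positivity
  nlinarith [mul_le_mul_of_nonneg_left h2 h3]

/-- The difference of two Weyl functions has moderate growth in strips, if it is entire. -/
lemma stripGrowth_sub_weyl (F : Fundamental s q S S1 C C1) (F' : Fundamental s' q' S' S1' C' C1')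
    {E : ℂ → ℂ} (hE : Differentiable ℂ E)
    (hEq : ∀ μ, E μ * (S μ Real.pi * S' μ Real.pi) =
      C' μ Real.pi * S μ Real.pi - C μ Real.pi * S' μ Real.pi) : StripGrowth E := by
  obtain ⟨A₁, hA₁, hG⟩ := (F.growthS _ pi_mem).mul (F'.growthS _ pi_mem)
  obtain ⟨A₂, hA₂, hF⟩ := ((F'.growthC _ pi_mem).mul (F.growthS _ pi_mem)).sub
    ((F.growthC _ pi_mem).mul (F'.growthS _ pi_mem))
  obtain ⟨T₁, c₁, hc₁, hlow⟩ := F.exists_lower_bound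
  obtain ⟨T₂, c₂, hc₂, hlow'⟩ := F'.exists_lower_bound
  intro T
  set H := max (max T 1) (max T₁ T₂) with hH
  have hH1 : 1 ≤ H := (le_max_right _ _).trans (le_max_left _ _)
  have hHT : T ≤ H := (le_max_left _ _).trans (le_max_left _ _)
  set K := A₁ * (1 + 9 * H) ^ 2 + A₂ * (1 + 9 * H) ^ 2 + (1 + H) ^ 2 / (c₁ * c₂) with hK
  have hK0 : 0 < K := by positivity
  refine ⟨6 * K, 0, fun z hz _ => ?_⟩
  set x := |z.re| with hx
  have hx0 : 0 ≤ x := abs_nonneg _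
  -- The quotient bound is applied in the disc of radius `8 H` about `z₀`, a point on a line where
  -- the denominator is under control.
  set z₀ : ℂ := z.re + H * Complex.I with hz₀
  have hz₀n : ‖z₀‖ ≤ x + H := by
    refine (norm_add_le _ _).trans ?_
    simp only [Complex.norm_real, norm_mul, Complex.norm_I, mul_one, Real.norm_eq_abs]
    rw [abs_of_pos (by linarith : 0 < H)]
  have hz₀im : z₀.im = H := by simp [hz₀]
  set A := K * (1 + x) ^ 2 with hA
  have hA0 : 0 < A := by positivity
  have hdisc : ∀ w : ℂ, ‖w‖ = 8 * H → (1 + ‖w + z₀‖) ^ 2 ≤ (1 + 9 * H) ^ 2 * (1 + x) ^ 2 := by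
    intro w hw
    have h1 : ‖w + z₀‖ ≤ x + 9 * H := (norm_add_le _ _).trans (by linarith)
    rw [← mul_pow]
    gcongr
    nlinarith
  have hup : ∀ w : ℂ, ‖w‖ = 8 * H → ‖S (w + z₀) Real.pi * S' (w + z₀) Real.pi‖ ≤ Real.exp A := by
    intro w hw
    refine (hG (w + z₀)).trans (Real.exp_le_exp.2 ?_)
    calc A₁ * (1 + ‖w + z₀‖) ^ 2 ≤ A₁ * ((1 + 9 * H) ^ 2 * (1 + x) ^ 2) := by
          gcongr; exact hdisc w hw
      _ = A₁ * (1 + 9 * H) ^ 2 * (1 + x) ^ 2 := by ring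
      _ ≤ A := by
          rw [hA]; gcongr; rw [hK]
          have : 0 ≤ A₂ * (1 + 9 * H) ^ 2 + (1 + H) ^ 2 / (c₁ * c₂) := by positivity
          linarith
  have hup' : ∀ w : ℂ, ‖w‖ = 8 * H →
      ‖E (w + z₀) * (S (w + z₀) Real.pi * S' (w + z₀) Real.pi)‖ ≤ Real.exp A := by
    intro w hw
    rw [hEq]
    refine (hF (w + z₀)).trans (Real.exp_le_exp.2 ?_)
    calc A₂ * (1 + ‖w + z₀‖) ^ 2 ≤ A₂ * ((1 + 9 * H) ^ 2 * (1 + x) ^ 2) := by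
          gcongr; exact hdisc w hw
      _ = A₂ * (1 + 9 * H) ^ 2 * (1 + x) ^ 2 := by ring
      _ ≤ A := by
          rw [hA]; gcongr; rw [hK]
          have : 0 ≤ A₁ * (1 + 9 * H) ^ 2 + (1 + H) ^ 2 / (c₁ * c₂) := by positivity
          linarith
  have hlo : Real.exp (-A) ≤ ‖S (0 + z₀) Real.pi * S' (0 + z₀) Real.pi‖ := by
    rw [zero_add, norm_mul]
    have h1 := hlow z₀ (by rw [hz₀im]; exact (le_max_left _ _).trans (le_max_right _ _))
    have h2 := hlow' z₀ (by rw [hz₀im]; exact (le_max_right _ _).trans (le_max_right _ _))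
    have h3 : c₁ * c₂ ≤ ‖z₀‖ ^ 2 * (‖S z₀ Real.pi‖ * ‖S' z₀ Real.pi‖) := by
      calc c₁ * c₂ ≤ (‖z₀‖ * ‖S z₀ Real.pi‖) * (‖z₀‖ * ‖S' z₀ Real.pi‖) := by gcongr
        _ = _ := by ring
    have h4 : ‖z₀‖ ^ 2 / (c₁ * c₂) ≤ Real.exp A := by
      calc ‖z₀‖ ^ 2 / (c₁ * c₂) ≤ ((1 + H) * (1 + x)) ^ 2 / (c₁ * c₂) := by
            gcongr; nlinarith
        _ = (1 + H) ^ 2 / (c₁ * c₂) * (1 + x) ^ 2 := by ring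
        _ ≤ A := by
            rw [hA]; gcongr; rw [hK]
            have : 0 ≤ A₁ * (1 + 9 * H) ^ 2 + A₂ * (1 + 9 * H) ^ 2 := by positivity
            linarith
        _ ≤ Real.exp A := by linarith [Real.add_one_le_exp A]
    rw [div_le_iff₀ (by positivity)] at h4
    rw [Real.exp_neg, inv_le_iff_one_le_mul₀ (Real.exp_pos _)]
    have hp : 0 ≤ ‖S z₀ Real.pi‖ * ‖S' z₀ Real.pi‖ := by positivity
    have h5 : c₁ * c₂ * 1 ≤ c₁ * c₂ * (Real.exp A * (‖S z₀ Real.pi‖ * ‖S' z₀ Real.pi‖)) := by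
      nlinarith [mul_le_mul_of_nonneg_right h4 hp]
    have := le_of_mul_le_mul_left h5 (by positivity)
    linarith
  obtain ⟨N, hN⟩ := pow_unbounded_of_one_lt
    (Real.exp A / ‖S (0 + z₀) Real.pi * S' (0 + z₀) Real.pi‖) (one_lt_two : (1 : ℝ) < 2)
  rw [div_lt_iff₀ ((Real.exp_pos _).trans_le hlo)] at hN
  have hshift : Differentiable ℂ fun w : ℂ => w + z₀ := by fun_prop
  have key := norm_quotient_le hA0 (by linarith : 0 < 8 * H) (hE.comp hshift) N
    (fun w => S (w + z₀) Real.pi * S' (w + z₀) Real.pi)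
    (((F.diffS _ pi_mem).mul (F'.diffS _ pi_mem)).comp hshift) hup hup' hlo hN.le (z - z₀) ?_
  · simp only [Function.comp_apply, sub_add_cancel] at key
    rwa [mul_assoc]
  · have : z - z₀ = ((z.im - H : ℝ) : ℂ) * Complex.I := by
      apply Complex.ext <;> simp [hz₀]
    rw [this, norm_mul, Complex.norm_I, mul_one, Complex.norm_real, Real.norm_eq_abs]
    refine (abs_sub _ _).trans ?_
    rw [abs_of_pos (by linarith : 0 < H)]
    linarith

end Fundamental

/-! ### Recovery of the coefficients from the Weyl function -/

namespace Fundamental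

variable {s q s' q' : ℝ → ℂ} {S S1 C C1 S' S1' C' C1' : ℂ → ℝ → ℂ}

lemma tendsto_sub_weyl (F : Fundamental s q S S1 C C1) (F' : Fundamental s' q' S' S1' C' C1')
    {E : ℂ → ℂ} (hEq : ∀ μ, E μ * (S μ Real.pi * S' μ Real.pi) =
      C' μ Real.pi * S μ Real.pi - C μ Real.pi * S' μ Real.pi) :
    Tendsto (fun μ => E μ / μ) upper (𝓝 0) := by
  have h := F.tendsto_weyl.sub F'.tendsto_weyl
  rw [sub_self] at h
  have hπ : Real.pi ∈ Set.Ioc 0 Real.pi := ⟨Real.pi_pos, le_rfl⟩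
  refine h.congr' ?_
  filter_upwards [F.eventually_S_ne_zero hπ, F'.eventually_S_ne_zero hπ,
    eventually_upper_ne_zero] with μ h1 h2 h3
  field_simp
  linear_combination -hEq μ

/-- If the difference of two Weyl functions is entire, then it is constant. -/
lemma sub_weyl_eq_const (F : Fundamental s q S S1 C C1) (F' : Fundamental s' q' S' S1' C' C1')
    {E : ℂ → ℂ} (hE : Differentiable ℂ E) (hEq : ∀ μ, E μ * (S μ Real.pi * S' μ Real.pi) =
      C' μ Real.pi * S μ Real.pi - C μ Real.pi * S' μ Real.pi) (μ : ℂ) : E μ = E 0 :=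
  eq_apply_zero_of_sublinear hE (F.stripGrowth_sub_weyl F' hE hEq) (F.tendsto_sub_weyl F' hEq)
    (F.neg.tendsto_sub_weyl F'.neg (E := fun μ => E (-μ)) fun μ => hEq (-μ)) μ

lemma tendsto_S_div_S (F : Fundamental s q S S1 C C1) (F' : Fundamental s' q' S' S1' C' C1')
    {x : ℝ} (hx : x ∈ Set.Ioc 0 Real.pi) :
    Tendsto (fun μ => S μ x / S' μ x) upper
      (𝓝 (Complex.exp (∫ t in (0 : ℝ)..x, Complex.I * q t) /
        Complex.exp (∫ t in (0 : ℝ)..x, Complex.I * q' t))) := by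
  refine ((F.tendsto_S hx).div (F'.tendsto_S hx) (Complex.exp_ne_zero _)).congr' ?_
  filter_upwards [eventually_upper_ne_zero] with μ hμ
  exact mul_div_mul_left _ _ (mul_ne_zero (mul_ne_zero (mul_ne_zero (by norm_num)
    Complex.I_ne_zero) hμ) (Complex.exp_ne_zero _))

/-- The expression is the difference of two products of the diagonal of a Green's function, which
tends to zero, and a bounded ratio of solutions. -/
lemma tendsto_crossed (F : Fundamental s q S S1 C C1) (F' : Fundamental s' q' S' S1' C' C1')
    {e : ℂ} (he : ∀ μ, e * (S μ Real.pi * S' μ Real.pi) =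
      C' μ Real.pi * S μ Real.pi - C μ Real.pi * S' μ Real.pi)
    {x : ℝ} (hx : x ∈ Set.Ioo 0 Real.pi) :
    Tendsto (fun μ => C μ x * S' μ x - S μ x * C' μ x + e * (S μ x * S' μ x)) upper (𝓝 0) := by
  have hxo : x ∈ Set.Ioc 0 Real.pi := ⟨hx.1, hx.2.le⟩
  have hπ : Real.pi ∈ Set.Ioc 0 Real.pi := ⟨Real.pi_pos, le_rfl⟩
  have h := ((F.tendsto_green hx).mul (F'.tendsto_S_div_S F hxo)).sub
    ((F'.tendsto_green hx).mul (F.tendsto_S_div_S F' hxo))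
  rw [zero_mul, zero_mul, sub_zero] at h
  refine h.congr' ?_
  filter_upwards [F.eventually_S_ne_zero hπ, F'.eventually_S_ne_zero hπ,
    F.eventually_S_ne_zero hxo, F'.eventually_S_ne_zero hxo] with μ h1 h2 h3 h4
  field_simp
  linear_combination -(S μ x * S' μ x) * he μ

section SameWeyl

variable (F : Fundamental s q S S1 C C1) (F' : Fundamental s' q' S' S1' C' C1') {e : ℂ}
  (he : ∀ μ, e * (S μ Real.pi * S' μ Real.pi) =
    C' μ Real.pi * S μ Real.pi - C μ Real.pi * S' μ Real.pi)
  {x : ℝ} (hx : x ∈ Set.Ioo 0 Real.pi)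

include F F' he hx

/-- The expression is entire in `μ` and tends to zero in both half-planes, so it vanishes by
Liouville's theorem. -/
lemma crossed_eq_zero (μ : ℂ) : C μ x * S' μ x - S μ x * C' μ x + e * (S μ x * S' μ x) = 0 := by
  have hxc : x ∈ Set.Icc 0 Real.pi := ⟨hx.1.le, hx.2.le⟩
  refine (eq_const_of_tendsto
    (f := fun μ => C μ x * S' μ x - S μ x * C' μ x + e * (S μ x * S' μ x)) ?_
    (QuadGrowth.stripGrowth ?_) (F.tendsto_crossed F' he hx)
    (F.neg.tendsto_crossed F'.neg (fun μ => he (-μ)) hx)).2 μ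
  · exact (((F.diffC x hxc).mul (F'.diffS x hxc)).sub ((F.diffS x hxc).mul (F'.diffC x hxc))).add
      (((F.diffS x hxc).mul (F'.diffS x hxc)).const_mul e)
  · exact (((F.growthC x hxc).mul (F'.growthS x hxc)).sub
      ((F.growthS x hxc).mul (F'.growthC x hxc))).add
      ((QuadGrowth.const e).mul ((F.growthS x hxc).mul (F'.growthS x hxc)))

/-- The solutions `S` are proportional, and the factor is read off from the asymptotics in both
half-planes. -/
lemma S_eq_ratio_mul :
    Complex.exp (∫ t in (0 : ℝ)..x, Complex.I * q t) /
        Complex.exp (∫ t in (0 : ℝ)..x, Complex.I * q' t) =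
      Complex.exp (∫ t in (0 : ℝ)..x, Complex.I * -q t) /
        Complex.exp (∫ t in (0 : ℝ)..x, Complex.I * -q' t) ∧
    ∀ μ, S μ x = Complex.exp (∫ t in (0 : ℝ)..x, Complex.I * q t) /
        Complex.exp (∫ t in (0 : ℝ)..x, Complex.I * q' t) * S' μ x := by
  have hxc : x ∈ Set.Icc 0 Real.pi := ⟨hx.1.le, hx.2.le⟩
  have hxo : x ∈ Set.Ioc 0 Real.pi := ⟨hx.1, hx.2.le⟩
  -- `Q` is an entire function, which equals `S / S'` by the vanishing of the crossed expression.
  set Q : ℂ → ℂ := fun μ => C μ x * S1' μ x - S μ x * (C1' μ x - e * S1' μ x) with hQ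
  have hQS : ∀ μ, Q μ * S' μ x = S μ x := fun μ => by
    have h1 := F.crossed_eq_zero F' he hx μ
    have h2 := F'.wronskian_eq_one μ hxc
    simp only [hQ]
    linear_combination S1' μ x * h1 + S μ x * h2
  have hd : Differentiable ℂ Q :=
    ((F.diffC x hxc).mul (F'.diffS1 x hxc)).sub ((F.diffS x hxc).mul
      ((F'.diffC1 x hxc).sub ((F'.diffS1 x hxc).const_mul e)))
  have hg : QuadGrowth Q :=
    ((F.growthC x hxc).mul (F'.growthS1 x hxc)).sub ((F.growthS x hxc).mul
      ((F'.growthC1 x hxc).sub ((QuadGrowth.const e).mul (F'.growthS1 x hxc))))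
  obtain ⟨hab, hc⟩ := eq_const_of_tendsto hd hg.stripGrowth
    ((F.tendsto_S_div_S F' hxo).congr' (by
      filter_upwards [F'.eventually_S_ne_zero hxo] with μ h
      rw [← hQS μ, mul_div_cancel_right₀ _ h]))
    ((F.neg.tendsto_S_div_S F'.neg hxo).congr' (by
      filter_upwards [F'.neg.eventually_S_ne_zero hxo] with μ h
      rw [← hQS (-μ), mul_div_cancel_right₀ _ h]))
  exact ⟨hab, fun μ => by rw [← hQS μ, hc μ]⟩

end SameWeyl

section Uniqueness

variable (F : Fundamental s q S S1 C C1) (F' : Fundamental s' q' S' S1' C' C1') {e : ℂ}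
  (he : ∀ μ, e * (S μ Real.pi * S' μ Real.pi) =
    C' μ Real.pi * S μ Real.pi - C μ Real.pi * S' μ Real.pi)

include F F' he

/-- The ratio `exp(i ∫₀ˣ (q - q'))` equals its inverse, so `exp(2 i ∫₀ˣ (q - q')) = 1`, and this can
be differentiated in `x`. -/
lemma ae_q_eq : ∀ᵐ x : ℝ, x ∈ Set.Ioo 0 Real.pi → q x = q' x := by
  have h1 := ACDeriv.primitive Real.pi_pos.le
    ((intervalIntegrable_of_memLp_two F.hq).const_mul Complex.I)
  have h2 := ACDeriv.primitive Real.pi_pos.le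
    ((intervalIntegrable_of_memLp_two F'.hq).const_mul Complex.I)
  have h := ((h1.sub h2).const_mul 2).comp (Complex.contDiff_exp) Complex.hasDerivAt_exp
  have hone : ∀ x ∈ Set.Ioo 0 Real.pi, Complex.exp (2 * ((∫ t in (0 : ℝ)..x, Complex.I * q t) -
      ∫ t in (0 : ℝ)..x, Complex.I * q' t)) = 1 := fun x hx => by
    have hr := (F.S_eq_ratio_mul F' he hx).1
    simp only [mul_neg, intervalIntegral.integral_neg, Complex.exp_neg] at hr
    rw [two_mul, Complex.exp_add, Complex.exp_sub]
    nth_rewrite 1 [hr]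
    have := Complex.exp_ne_zero (∫ t in (0 : ℝ)..x, Complex.I * q t)
    have := Complex.exp_ne_zero (∫ t in (0 : ℝ)..x, Complex.I * q' t)
    field_simp
  filter_upwards [h.deriv_ae] with x hd hx
  have hz := (hd hx).unique ((hasDerivAt_const x (1 : ℂ)).congr_of_eventuallyEq (by
    filter_upwards [Ioo_mem_nhds hx.1 hx.2] with y hy using hone y hy))
  rw [hone x hx, one_mul, ← mul_sub] at hz
  simpa [sub_eq_zero] using hz

lemma S_eq {x : ℝ} (hx : x ∈ Set.Ioo 0 Real.pi) (μ : ℂ) : S μ x = S' μ x := by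
  have hi : (∫ t in (0 : ℝ)..x, Complex.I * q t) = ∫ t in (0 : ℝ)..x, Complex.I * q' t := by
    refine intervalIntegral.integral_congr_ae ?_
    filter_upwards [F.ae_q_eq F' he] with t ht hm
    rw [Set.uIoc_of_le hx.1.le] at hm
    rw [ht ⟨hm.1, hm.2.trans_lt hx.2⟩]
  rw [(F.S_eq_ratio_mul F' he hx).2 μ, hi, div_self (Complex.exp_ne_zero _), one_mul]

/-- Once `S = S'`, the identity `crossed_eq_zero` reads `S (C + e S - C') = 0`, and `S` is not
identically zero in `μ`. -/
lemma C_eq {x : ℝ} (hx : x ∈ Set.Ioo 0 Real.pi) (μ : ℂ) : C' μ x = C μ x + e * S μ x := by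
  have hxc : x ∈ Set.Icc 0 Real.pi := ⟨hx.1.le, hx.2.le⟩
  have hdS := F.diffS x hxc
  have hd : Differentiable ℂ (fun μ => C μ x + e * S μ x - C' μ x) :=
    ((F.diffC x hxc).add (hdS.const_mul e)).sub (F'.diffC x hxc)
  have hor := AnalyticOnNhd.eq_zero_or_eq_zero_of_mul_eq_zero (𝕜 := ℂ)
    (U := Set.univ) (f := fun μ => S μ x) (g := fun μ => C μ x + e * S μ x - C' μ x)
    (fun z _ => hdS.analyticAt z) (fun z _ => hd.analyticAt z) (fun z _ => by
      have := F.crossed_eq_zero F' he hx z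
      rw [← F.S_eq F' he hx z] at this
      linear_combination this) isPreconnected_univ
  rcases hor with h | h
  · obtain ⟨z, hz⟩ := (F.eventually_S_ne_zero (x := x) ⟨hx.1, hx.2.le⟩).exists
    exact absurd (h z trivial) hz
  · linear_combination -h μ trivial

/-- The antiderivatives `σ` differ by a constant: their difference equals a bilinear expression in
absolutely continuous functions, whose derivative vanishes. -/
lemma ae_s_sub_eq_const : ∃ c : ℂ, ∀ᵐ x : ℝ, x ∈ Set.Ioo 0 Real.pi → s' x - s x = c := by
  have hy := F.solS 0
  have hz := (F.solC 0).comb (F.solS 0) 1 e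
  have hy' := F'.solS 0
  have hz' := F'.solC 0
  set y := S 0
  set y1 := S1 0
  set z : ℝ → ℂ := fun x => 1 * C 0 x + e * S 0 x with hzdef
  set z1 : ℝ → ℂ := fun x => 1 * C1 0 x + e * S1 0 x with hz1def
  have eqy : ∀ x ∈ Set.Ioo 0 Real.pi, S' 0 x = y x := fun x hx => (F.S_eq F' he hx 0).symm
  have eqz : ∀ x ∈ Set.Ioo 0 Real.pi, C' 0 x = z x := fun x hx => by
    rw [F.C_eq F' he hx 0, hzdef]; ring
  have hder : ∀ {f g f' g' : ℝ → ℂ}, ACDeriv f f' 0 Real.pi → ACDeriv g g' 0 Real.pi →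
      (∀ x ∈ Set.Ioo 0 Real.pi, g x = f x) →
      ∀ᵐ x : ℝ, x ∈ Set.Ioo 0 Real.pi → g' x = f' x := fun hf hg hfg => by
    filter_upwards [hf.deriv_ae, hg.deriv_ae] with x a b hx
    refine (b hx).unique ((a hx).congr_of_eventuallyEq ?_)
    filter_upwards [Ioo_mem_nhds hx.1 hx.2] with t ht using hfg t ht
  have hw := hder hy.fst hy'.fst eqy
  have hv := hder hz.fst hz'.fst eqz
  have hwr : ∀ x ∈ Set.Ioo 0 Real.pi, y1 x * z x - y x * z1 x = 1 := fun x hx => by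
    have := F.wronskian_eq_one 0 ⟨hx.1.le, hx.2.le⟩
    simp only [hzdef, hz1def]
    linear_combination this
  -- The differences of the quasi-derivatives are `(s' - s) y` and `(s' - s) z`, so the Wronskian
  -- identity turns this combination into `s' - s`.
  have hd := (((hz.snd.sub hz'.snd).mul hy.snd).sub
    ((hy.snd.sub hy'.snd).mul hz.snd)).congr_deriv (g' := fun _ => 0) (by
      filter_upwards [hw, hv] with x a b hx
      have a := a hx
      have b := b hx
      rw [eqy x hx] at a
      rw [eqz x hx] at b
      have ea : S1' 0 x = y1 x + s x * y x - s' x * y x := by linear_combination a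
      have eb : C1' 0 x = z1 x + s x * z x - s' x * z x := by linear_combination b
      rw [eqy x hx, eqz x hx, ea, eb]
      ring)
  refine ⟨(z1 0 - C1' 0 0) * y1 0 - (y1 0 - S1' 0 0) * z1 0, ?_⟩
  filter_upwards [hw, hv] with x a b hx
  have a := a hx
  have b := b hx
  rw [eqy x hx] at a
  rw [eqz x hx] at b
  refine Eq.trans ?_ (hd.sub_eq_of_deriv_zero (x := x) ⟨hx.1.le, hx.2.le⟩)
  have ea : S1' 0 x = y1 x + s x * y x - s' x * y x := by linear_combination a
  have eb : C1' 0 x = z1 x + s x * z x - s' x * z x := by linear_combination b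
  rw [ea, eb]
  linear_combination -(s' x - s x) * hwr x hx

end Uniqueness

end Fundamental

/-! ### Spectral data and the uniqueness theorem -/

/-- Each power of `μ - z` below the multiplicity of the eigenvalue `z` is recorded in the residues at
an index `n + ν` different from zero, where sequences over `ℤ \ {0}` carry no information. -/
lemma IsOrdered.exists_firstIndex {lam : ℤ → ℂ} (h : IsOrdered lam) {z : ℂ}
    (hfin : {n : ℤ | n ≠ 0 ∧ lam n = z}.Finite) {ν : ℕ}
    (hν : ν < {n : ℤ | n ≠ 0 ∧ lam n = z}.ncard) :
    ∃ n ∈ firstIndices lam, lam n = z ∧ ν < mult lam n ∧ n + ν ≠ 0 := by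
  have hne : {n : ℤ | n ≠ 0 ∧ lam n = z}.Nonempty :=
    (Set.ncard_pos hfin).1 ((Nat.zero_le ν).trans_lt hν)
  obtain ⟨n, ⟨hn0, hnz⟩, hmin⟩ := Set.exists_min_image _ id hfin hne
  have hm : mult lam n = {n : ℤ | n ≠ 0 ∧ lam n = z}.ncard := by rw [mult, hnz]
  refine ⟨n, ⟨hn0, fun k hk hkn e => ?_⟩, hnz, hm ▸ hν, fun h0 => ?_⟩
  · exact absurd (hmin k ⟨hk, e.trans hnz⟩) (not_le.2 hkn)
  · -- Here `n < 0`, so by the sign convention all indices of `z` lie in `[n, 0)`.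
    have hsub : {n : ℤ | n ≠ 0 ∧ lam n = z} ⊆ Finset.Ico n 0 := fun k hk => by
      rw [Finset.coe_Ico]
      refine ⟨hmin k hk, ?_⟩
      by_contra! hk0
      have hkpos : 0 < k := lt_of_le_of_ne hk0 hk.1.symm
      exact h.sign n k (mul_neg_of_neg_of_pos (by omega) hkpos) (hnz.trans hk.2.symm)
    have hle := Set.ncard_le_ncard hsub (Finset.finite_toSet _)
    rw [Set.ncard_coe_finset, Int.card_Ico] at hle
    omega

lemma mult_congr {lam lamt : ℤ → ℂ} (h : ∀ n : ℤ, n ≠ 0 → lam n = lamt n) {n : ℤ} (hn : n ≠ 0) :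
    mult lam n = mult lamt n := by
  unfold mult
  congr 1
  ext k
  refine and_congr_right fun hk => ?_
  rw [h k hk, h n hn]

lemma firstIndices_congr {lam lamt : ℤ → ℂ} (h : ∀ n : ℤ, n ≠ 0 → lam n = lamt n) :
    firstIndices lam = firstIndices lamt := by
  ext n
  refine and_congr_right fun hn => forall_congr' fun k => forall_congr' fun hk => ?_
  rw [h k hk, h n hn]

lemma Fundamental.charFunction_eq {σ q₁ : L2} {Δ : ℂ → ℂ} {S S1 C C1 : ℂ → ℝ → ℂ}
    (F : Fundamental σ q₁ S S1 C C1) (h : IsCharFunction σ q₁ Δ) : Δ = fun μ => S μ Real.pi := by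
  ext μ
  obtain ⟨y, y1, hy, h0, h1, h2⟩ := h μ
  have := Sol.eq_comb (F.solS μ) (F.solC μ) (F.S0 μ) (F.S10 μ) (F.C0 μ) (F.C10 μ) hy.sol pi_mem
  rw [h2, this, h0, h1]; ring

lemma Fundamental.weylFunction_eq {σ q₁ : L2} {W : ℂ → ℂ} {S S1 C C1 : ℂ → ℝ → ℂ}
    (F : Fundamental σ q₁ S S1 C C1) (h : IsWeylFunction σ q₁ (fun μ => S μ Real.pi) W) {μ : ℂ}
    (hμ : S μ Real.pi ≠ 0) : W μ = -C μ Real.pi / S μ Real.pi := by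
  obtain ⟨y, y1, hy, h0, h1, h2⟩ := h μ hμ
  have := Sol.eq_comb (F.solS μ) (F.solC μ) (F.S0 μ) (F.S10 μ) (F.C0 μ) (F.C10 μ) hy.sol pi_mem
  rw [h0, h1, ← h2] at this
  rw [eq_div_iff hμ]
  linear_combination -this

lemma Fundamental.analyticOrderAt_ne_top {s q : ℝ → ℂ} {S S1 C C1 : ℂ → ℝ → ℂ}
    (F : Fundamental s q S S1 C C1) (z : ℂ) : analyticOrderAt (fun μ => S μ Real.pi) z ≠ ⊤ := by
  intro h
  have hd := F.diffS _ pi_mem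
  have h0 := AnalyticOnNhd.eqOn_zero_of_preconnected_of_eventuallyEq_zero (𝕜 := ℂ)
    (U := Set.univ) (f := fun μ => S μ Real.pi) (fun z _ => hd.analyticAt z) isPreconnected_univ
    (Set.mem_univ z) (analyticOrderAt_eq_top.1 h)
  obtain ⟨w, hw⟩ := (F.eventually_S_ne_zero (x := Real.pi) ⟨Real.pi_pos, le_rfl⟩).exists
  exact hw (h0 (Set.mem_univ w))

/-- A distribution is determined by its antiderivative modulo constants. -/
lemma IsDistribDeriv.unique {σ σt : L2} {q₀ q₀t : Distr} (h : IsDistribDeriv σ q₀)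
    (ht : IsDistribDeriv σt q₀t) {c : ℂ}
    (hc : ∀ᵐ x : ℝ, x ∈ Set.Ioo 0 Real.pi → σt x - σ x = c) : q₀ = q₀t := by
  refine DFunLike.ext _ _ fun φ => ?_
  have hφ : ContDiff ℝ 1 φ := φ.contDiff.of_le (by exact_mod_cast le_top)
  have hφ' : Continuous (deriv φ) := hφ.continuous_deriv le_rfl
  have hint : ∀ τ : L2, IntegrableOn (fun x => ((deriv φ x : ℝ) : ℂ) * τ x) (Set.Ioo 0 Real.pi) :=
    fun τ => by
      obtain ⟨B, hB⟩ := (isCompact_Icc (a := (0 : ℝ)) (b := Real.pi)).exists_bound_of_continuousOn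
        hφ'.continuousOn
      refine (integrableOn_of_memLp_two (Lp.memLp τ)).bdd_mul (c := B)
        (Complex.continuous_ofReal.comp hφ').aestronglyMeasurable ?_
      filter_upwards [ae_restrict_mem measurableSet_Ioo] with x hx
      simpa using hB x (Set.Ioo_subset_Icc_self hx)
  have hend : ∀ x : ℝ, x ∉ Set.Ioo 0 Real.pi → φ x = 0 := fun x hx =>
    image_eq_zero_of_notMem_tsupport fun hm => hx (φ.tsupport_subset hm)
  have hzero : ∫ x in Set.Ioo 0 Real.pi, ((deriv φ x : ℝ) : ℂ) = 0 := by
    rw [integral_complex_ofReal, ← integral_Ioc_eq_integral_Ioo,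
      ← intervalIntegral.integral_of_le Real.pi_pos.le,
      intervalIntegral.integral_deriv_eq_sub
        (fun x _ => (hφ.differentiable one_ne_zero).differentiableAt)
        (hφ'.intervalIntegrable _ _), hend 0 (by simp), hend Real.pi (by simp)]
    simp
  rw [h φ, ht φ, neg_inj, eq_comm, ← sub_eq_zero, ← integral_sub (hint σt) (hint σ)]
  calc _ = ∫ x in Set.Ioo 0 Real.pi, ((deriv φ x : ℝ) : ℂ) * c := by
        refine integral_congr_ae ((ae_restrict_iff' measurableSet_Ioo).2 ?_)
        filter_upwards [hc] with x hx hm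
        rw [← mul_sub, hx hm]
    _ = 0 := by rw [integral_mul_const, hzero, zero_mul]

end QuadraticPencil

theorem theorem2p3
    (q₀ q₀t : QuadraticPencil.Distr)
    (hq₀ : QuadraticPencil.MemW2NegOne q₀) (hq₀t : QuadraticPencil.MemW2NegOne q₀t)
    (q₁ q₁t : QuadraticPencil.L2)
    (lam M lamt Mt : ℤ → ℂ)
    (hdata : QuadraticPencil.IsSpectralData q₀ q₁ lam M)
    (hdatat : QuadraticPencil.IsSpectralData q₀t q₁t lamt Mt)
    (hlam : ∀ n : ℤ, n ≠ 0 → lam n = lamt n)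
    (hM : ∀ n : ℤ, n ≠ 0 → M n = Mt n) :
    q₀ = q₀t ∧ q₁ = q₁t := by
  open QuadraticPencil in
  obtain ⟨σ, Δ, W, hσ, hΔ, hW, hord, hlo, hres⟩ := hdata
  obtain ⟨σt, Δt, Wt, hσt, hΔt, hWt, hordt, -, hrest⟩ := hdatat
  obtain ⟨S, S1, C, C1, F⟩ := exists_fundamental (Lp.memLp σ) (Lp.memLp q₁)
  obtain ⟨St, S1t, Ct, C1t, Ft⟩ := exists_fundamental (Lp.memLp σt) (Lp.memLp q₁t)
  obtain rfl := F.charFunction_eq hΔ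
  obtain rfl := Ft.charFunction_eq hΔt
  have hset : ∀ z, {n : ℤ | n ≠ 0 ∧ lam n = z} = {n : ℤ | n ≠ 0 ∧ lamt n = z} := fun z => by
    ext n
    refine and_congr_right fun hn => ?_
    rw [hlam n hn]
  obtain ⟨E, hE, hEq⟩ := exists_entire_sub_weyl (F.diffS _ pi_mem) (Ft.diffS _ pi_mem)
    (F.diffC _ pi_mem) (Ft.diffC _ pi_mem) (fun z => by rw [← hord, ← hordt, hset])
    F.analyticOrderAt_ne_top (fun z => F.weylFunction_eq hW) (fun z => Ft.weylFunction_eq hWt)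
    (fun z ν hν => by
      have hfin : {n : ℤ | n ≠ 0 ∧ lam n = z}.Finite := by
        rw [← Set.encard_ne_top_iff, hord]; exact F.analyticOrderAt_ne_top z
      rw [← hord, ← hfin.cast_ncard_eq, Nat.cast_lt] at hν
      obtain ⟨n, hn, hnz, hνn, h0⟩ := hlo.exists_firstIndex hfin hν
      have h1 := hres n hn ν hνn
      have h2 := hrest n (firstIndices_congr hlam ▸ hn) ν (mult_congr hlam hn.1 ▸ hνn)
      rw [← hM _ h0, ← hlam n hn.1] at h2
      rw [hnz] at h1 h2
      exact ⟨_, h1, h2⟩)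
  have he : ∀ μ, E 0 * (S μ Real.pi * St μ Real.pi) =
      Ct μ Real.pi * S μ Real.pi - C μ Real.pi * St μ Real.pi := fun μ => by
    rw [← F.sub_weyl_eq_const Ft hE hEq μ, hEq μ]
  obtain ⟨c, hc⟩ := F.ae_s_sub_eq_const Ft he
  exact ⟨hσ.unique hσt hc,
    Lp.ext ((ae_restrict_iff' measurableSet_Ioo).2 (F.ae_q_eq Ft he))⟩
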